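/- **Theorem (a Ryll-Nardzewski theorem for the logic of co-valuations).** *Definitions.* Fix a countably infinite set of variables with a distinguished variable $*$; a *context* is a finite set of variables. A *co-valuation* on a set $M$ in a set $X$ is a relation $v\subseteq X\times M$ such that the sets $[x]_v=\{a:(x,a)\in v\}$, $x\in X$, cover $M$ and each $[x]_v$ contains a point lying in no $[x']_v$ with $x'\neq x$; the set of such points is denoted $[x]_{\pi_v}$. Write $\mathrm{Val}(X,M)$ for the set of these. For ${\geq}\in\mathrm{Val}(X,Y)$ and $w\in \mathrm{Val}(Y,M)$, the composition $C_\geq(w)={\geq}\circ w\in\mathrm{Val}(X,M)$ is a *consolidation* of $w$, and $w$ is a *fragmentation* of $C_\geq(w)$. Let $L$ be a relational signature. Formulas $\phi(X)$ in context $X$ are generated by $\bot$, $R(\bar x)$ ($R\in L$, $\bar x$ a tuple in $X$), $\neg\phi(X)$, $\phi(X)\wedge\psi(X)$, and $\exists^{\mathrm{fr}}_{\geq}\phi(Y)$ with ${\geq}\in\mathrm{Val}(X,Y)$, $Y$ a context. Sentences are formulas in context $\{*\}$; a theory is a set of sentences. A *structure* in signature $L$ is a nonempty first-order $L$-structure $M$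 with a nonempty family $V$ of (*admissible*) co-valuations on $M$ in contexts, closed under consolidations in contexts, such that (I) any two members of $V$ have a common fragmentation in $V$; (II) whenever $R\in L$, $v\in V$ is in context $X$, and $\bar x$ is a tuple in $X$ with $R^M\cap\prod_k[x_k]_v\ne\emptyset$, there are $w\in V$ in some context $Y$, a tuple $\bar y$ in $Y$ with $[y_k]_w\subseteq[x_k]_v$ for all $k$, and $a_k\in[y_k]_{\pi_w}$ with $R^M(\bar a)$. For $v\in V$ in context $X$, satisfaction $M\models_v\phi(X)$ is defined by: $M\models_v R(\bar x)$ iff $R^M\cap\prod_k[x_k]_v\neq\emptyset$; $M\models_v\exists^{\mathrm{fr}}_\geq\phi$ iff there is $w\in V$ with $v=C_\geq(w)$ and $M\models_w\phi$; and the usual clauses for $\bot,\neg,\wedge$. For a sentence, $v$ is the unique co-valuation in $\{*\}$. A *model* of $T$ is a structure satisfying all sentences of $T$. A structure $(M,V)$ is * an *$\omega$-structure* if there are $v_0,v_1,\dots\in V$ such that each $v_i$ is a consolidation of $v_{i+1}$ and each $v\in V$ is a consolidation of some $v_i$; * *compact* if there is a compact $T_1$ topology on $M$ such that all sets $[x]_v$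 ($v\in V$) are open, every open cover of $M$ is refined by the cover $\{[x]_v\}_x$ for some $v\in V$, and all relations of $M$ are closed. A *compact $\omega$-model* of $T$ is a model of $T$ that is a compact $\omega$-structure. An isomorphism is a bijection that preserves the relations in both directions and carries the admissible co-valuations of one structure onto those of the other. $T$ is *$\omega$-categorical* if it has exactly one compact $\omega$-model up to isomorphism. $T$ is *consistent* if it has a model, and *complete* if for every sentence $\phi$, either $\phi$ holds in all models of $T$ or $\neg\phi$ does. A *type of $T$* is a set $p(X)$ of formulas in one context $X$ that is realized in some model of $T$ (there are a model $(M,V)$ of $T$ and $v\in V$ in context $X$ with $M\models_v\phi$ for all $\phi\in p$). It is *isolated* if there is a formula $\phi(X)$, with $\{\phi\}$ a type of $T$, such that in every model $(M,V)$ of $T$, for all $v\in V$ in context $X$, $M\models_v\phi$ implies $M\models_v\psi$ for all $\psi\in p$. $S_n(T)$ is the set of types $p$ of $T$ in a fixed context of size $n$ that are complete, i.e. contain $\phi$ or $\neg\phi$ for every formula $\phi$ in that context. *Statement.* Let $T$ be a theory in a countable relational signature, and consider 1. $T$ is $\omega$-categorical; 2. every type of $T$ is isolated; 3. $S_n(T)$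 is finite for every $n\in\mathbb N$. Then $(1)\Rightarrow(2)\Leftrightarrow(3)$. If moreover $T$ is consistent and complete, then (1), (2) and (3) are equivalent. -/

import Mathlib

universe u v w

namespace CovLogic

/-! ### Co-valuations -/

/-- A co-valuation on `M` in `X`: a co-bijective relation `rel ⊆ X × M`, that is, one for which
the sets `[x] = {a | rel x a}` form a minimal cover of `M` indexed by `X`. -/
@[ext]
structure CoVal (X : Type*) (M : Type*) where
  rel : X → M → Prop
  cosurj : ∀ a, ∃ x, rel x a
  coinj : ∀ x, ∃ a, rel x a ∧ ∀ x', rel x' a → x' = x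

namespace CoVal

variable {X Y M N : Type*}

/-- The set `[x]_v`. -/
def cell (v : CoVal X M) (x : X) : Set M := {a | v.rel x a}

/-- The set `[x]_{π_v}` of those `a` that belong to `[x]_v` and to no other `[x']_v`. -/
def core (v : CoVal X M) (x : X) : Set M := {a | v.rel x a ∧ ∀ x', v.rel x' a → x' = x}

/-- The consolidation `C_≥(w) = ≥ ∘ w` of `w` with pattern `≥ = g`. -/
def consolidate (g : CoVal X Y) (w : CoVal Y M) : CoVal X M where
  rel x a := ∃ y, g.rel x y ∧ w.rel y a
  cosurj a := by
    obtain ⟨y, hy⟩ := w.cosurj a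
    obtain ⟨x, hx⟩ := g.cosurj y
    exact ⟨x, y, hx, hy⟩
  coinj x := by
    obtain ⟨y, hy, hy'⟩ := g.coinj x
    obtain ⟨a, ha, ha'⟩ := w.coinj y
    refine ⟨a, ⟨y, hy, ha⟩, ?_⟩
    rintro x' ⟨y', h1, h2⟩
    obtain rfl := ha' y' h2
    exact hy' x' h1

/-- `v` is a consolidation of `w` (equivalently, `w` is a fragmentation of `v`). -/
def Consolidates (v : CoVal X M) (w : CoVal Y M) : Prop :=
  ∃ g : CoVal X Y, v = consolidate g w

/-- The image `f[v]` of a co-valuation under a bijection. -/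
def map (f : M ≃ N) (v : CoVal X M) : CoVal X N where
  rel x b := v.rel x (f.symm b)
  cosurj b := v.cosurj (f.symm b)
  coinj x := by
    obtain ⟨a, ha, ha'⟩ := v.coinj x
    exact ⟨f a, by simpa using ha, by simpa using ha'⟩

end CoVal

/-! ### Contexts and formulas -/

/-- A context is a finite set of variables; the variables are the natural numbers. -/
abbrev Context := Finset ℕ

/-- The special variable `*` is `0`; this is the context `{*}`. -/
abbrev star : Context := {0}

/-- Formulas in a given context over the relational signature `L`. The constructor `ex` is the
quantifier `∃^fr_≥`, where the pattern `≥` is a co-valuation on `Y` in `X`. -/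
inductive Formula (L : FirstOrder.Language.{u, v}) : Context → Type v
  | bot {X : Context} : Formula L X
  | rel {X : Context} {n : ℕ} (R : L.Relations n) (x : Fin n → X) : Formula L X
  | neg {X : Context} (φ : Formula L X) : Formula L X
  | and {X : Context} (φ ψ : Formula L X) : Formula L X
  | ex {X Y : Context} (g : CoVal X Y) (φ : Formula L Y) : Formula L X

/-- A sentence is a formula in the context `{*}`; a theory is a set of sentences. -/
abbrev Theory (L : FirstOrder.Language.{u, v}) := Set (Formula L star)

/-! ### Proto-structures and satisfaction -/

/-- A proto-structure: a (nonempty) first-order structure together with a family `V` of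
admissible co-valuations in contexts that is closed under consolidations by contexts. -/
structure ProtoStructure (L : FirstOrder.Language.{u, v}) where
  carrier : Type w
  nonempty : Nonempty carrier
  str : L.Structure carrier
  V : (X : Context) → Set (CoVal X carrier)
  closed : ∀ {X Y : Context} (g : CoVal X Y), ∀ w ∈ V Y, CoVal.consolidate g w ∈ V X

attribute [instance] ProtoStructure.nonempty ProtoStructure.str

variable {L : FirstOrder.Language.{u, v}}

namespace ProtoStructure

/-- The satisfaction relation `M ⊨_v φ`. -/
def Sat (M : ProtoStructure.{u, v, w} L) :
    {X : Context} → Formula L X → CoVal X M.carrier → Prop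
  | _, .bot, _ => False
  | _, .rel R x, v =>
      ∃ a : _ → M.carrier, (∀ k, a k ∈ v.cell (x k)) ∧ FirstOrder.Language.Structure.RelMap R a
  | _, .neg φ, v => ¬ M.Sat φ v
  | _, .and φ ψ, v => M.Sat φ v ∧ M.Sat ψ v
  | _, .ex (Y := Y) g φ, v => ∃ w ∈ M.V Y, v = CoVal.consolidate g w ∧ M.Sat φ w

/-- The unique co-valuation on `M` in the context `{*}`. -/
def total (M : ProtoStructure.{u, v, w} L) : CoVal star M.carrier where
  rel _ _ := True
  cosurj _ := ⟨⟨0, by simp⟩, trivial⟩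
  coinj x := ⟨Classical.arbitrary _, trivial, fun x' _ => by
    have h1 := Finset.mem_singleton.1 x.2
    have h2 := Finset.mem_singleton.1 x'.2
    exact Subtype.ext (h2.trans h1.symm)⟩

/-- A structure is a proto-structure whose family of admissible co-valuations is (nonempty and)
directed under fragmentation and satisfies the witness axiom for relations. -/
structure IsStructure (M : ProtoStructure.{u, v, w} L) : Prop where
  nonempty_V : ∃ X : Context, (M.V X).Nonempty
  directed : ∀ (X Y : Context), ∀ p ∈ M.V X, ∀ q ∈ M.V Y,
    ∃ Z : Context, ∃ r ∈ M.V Z, p.Consolidates r ∧ q.Consolidates r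
  witness : ∀ (n : ℕ) (R : L.Relations n) (X : Context), ∀ p ∈ M.V X, ∀ x : Fin n → X,
    M.Sat (.rel R x) p →
      ∃ Y : Context, ∃ q ∈ M.V Y, ∃ (y : Fin n → Y) (a : Fin n → M.carrier),
        (∀ k, a k ∈ q.core (y k)) ∧ (∀ k, q.cell (y k) ⊆ p.cell (x k)) ∧
          FirstOrder.Language.Structure.RelMap R a

/-- An `ω`-structure is a structure whose admissible co-valuations are generated by an
`ω`-chain `p 0, p 1, …` of admissible co-valuations. -/
def IsOmega (M : ProtoStructure.{u, v, w} L) : Prop :=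
  ∃ (X : ℕ → Context) (p : (i : ℕ) → CoVal (X i) M.carrier),
    (∀ i, p i ∈ M.V (X i)) ∧ (∀ i, (p i).Consolidates (p (i + 1))) ∧
      ∀ (Y : Context), ∀ q ∈ M.V Y, ∃ i, q.Consolidates (p i)

/-- Compactness: there is a compact `T₁` topology on `M` in which admissible co-valuations give
open covers, every open cover is refined by an admissible one, and all relations are closed. -/
def IsCompact (M : ProtoStructure.{u, v, w} L) : Prop :=
  ∃ _ : TopologicalSpace M.carrier, CompactSpace M.carrier ∧ T1Space M.carrier ∧
    (∀ (X : Context), ∀ p ∈ M.V X, ∀ x, IsOpen (p.cell x)) ∧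
    (∀ U : Set (Set M.carrier), (∀ s ∈ U, IsOpen s) → ⋃₀ U = Set.univ →
      ∃ X : Context, ∃ p ∈ M.V X, ∀ x, ∃ s ∈ U, p.cell x ⊆ s) ∧
    (∀ (n : ℕ) (R : L.Relations n),
      IsClosed {a : Fin n → M.carrier | FirstOrder.Language.Structure.RelMap R a})

/-- `M` and `N` are isomorphic: some bijection preserves the relations in both directions and
carries the admissible co-valuations of `M` onto those of `N`. -/
def Isomorphic (M N : ProtoStructure.{u, v, w} L) : Prop :=
  ∃ f : L.Equiv M.carrier N.carrier,
    ∀ X : Context, CoVal.map f.toEquiv '' M.V X = N.V X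

/-- `M` is a model of `T`: a structure satisfying every sentence in `T`. -/
def IsModel (M : ProtoStructure.{u, v, w} L) (T : Theory L) : Prop :=
  M.IsStructure ∧ ∀ φ ∈ T, M.Sat φ M.total

/-- `M` is a compact `ω`-model of `T`. -/
def IsCompactOmegaModel (M : ProtoStructure.{u, v, w} L) (T : Theory L) : Prop :=
  M.IsModel T ∧ M.IsCompact ∧ M.IsOmega

/-- The type `p` in context `X` is realized in `M`. -/
def Realizes (M : ProtoStructure.{u, v, w} L) {X : Context} (p : Set (Formula L X)) : Prop :=
  ∃ q ∈ M.V X, ∀ φ ∈ p, M.Sat φ q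

end ProtoStructure

/-! ### Theories and types -/

namespace Theory

/-- `T` has a model. -/
def Consistent (T : Theory L) : Prop :=
  ∃ M : ProtoStructure.{u, v, w} L, M.IsModel T

/-- `T` decides every sentence: it entails `φ` or it entails `¬ φ`. -/
def Complete (T : Theory L) : Prop :=
  ∀ φ : Formula L star,
    (∀ M : ProtoStructure.{u, v, w} L, M.IsModel T → M.Sat φ M.total) ∨
    (∀ M : ProtoStructure.{u, v, w} L, M.IsModel T → M.Sat (.neg φ) M.total)

/-- `p` is a type of `T`: it is realized in some model of `T`. -/
def IsTypeOf (T : Theory L) {X : Context} (p : Set (Formula L X)) : Prop :=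
  ∃ M : ProtoStructure.{u, v, w} L, M.IsModel T ∧ M.Realizes p

/-- `p` is isolated relative to `T`: some formula `φ` that is consistent with `T` implies, modulo
`T`, every formula in `p`. -/
def IsIsolated (T : Theory L) {X : Context} (p : Set (Formula L X)) : Prop :=
  ∃ φ : Formula L X, IsTypeOf.{u, v, w} T {φ} ∧
    ∀ M : ProtoStructure.{u, v, w} L, M.IsModel T → ∀ q ∈ M.V X, M.Sat φ q →
      ∀ ψ ∈ p, M.Sat ψ q

/-- Every type of `T` (in any context) is isolated. -/
def EveryTypeIsolated (T : Theory L) : Prop :=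
  ∀ (X : Context) (p : Set (Formula L X)), IsTypeOf.{u, v, w} T p → IsIsolated.{u, v, w} T p

/-- The type space `S_n(T)`: all complete types, in the fixed context `{0, …, n - 1}` of size `n`,
that are realized in models of `T`. -/
def typeSpace (T : Theory L) (n : ℕ) : Set (Set (Formula L (Finset.range n))) :=
  {p | (∀ φ : Formula L (Finset.range n), φ ∈ p ∨ .neg φ ∈ p) ∧ IsTypeOf.{u, v, w} T p}

/-- `T` is `ω`-categorical: up to isomorphism it has exactly one compact `ω`-model. -/
def OmegaCategorical (T : Theory L) : Prop :=
  ∃ M : ProtoStructure.{u, v, w} L, M.IsCompactOmegaModel T ∧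
    ∀ N : ProtoStructure.{u, v, w} L, N.IsCompactOmegaModel T → M.Isomorphic N

end Theory

end CovLogic

/-! Compact `ω`-models are built by a Henkin-style forcing and compared by back and forth. A
sequence of finite contexts linked by co-valuations (a `Tower`) has a compact T₁ limit, whose points
are the minimal selectors. A coherent assignment of truth values along it (a `Valuation`) makes the
limit a compact `ω`-structure with the prescribed satisfaction (`Tower.Valuation.sat_iff`).
Conversely, a compact `ω`-structure is recovered from a cofinal chain of co-valuations and their
types (`Presentation.isomorphic`).

Suitable towers come from generic sequences of conditions over a filtered family of structures
(`Family.exists_compact_omega`). A single structure yields realization of types, a sequence with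
`atTop` yields compactness, and all models of `T` with the filter `⊤` yield omitting types. The
engine is a size bound: common fragmentations and witnesses for relations exist in contexts of
bounded size, so the choices involved are finite disjunctions.

(1) ⇒ (2): a non-isolated type is realized in one compact `ω`-model and omitted in another. (2) ⇒
(3): infinitely many types in `S_n`, each singled out by a formula, would be countable in number,
and compactness would produce one more. (3) ⇒ (2): finitely many complete types are separated by
formulas. (2) ⇒ (1): isolating formulas transfer fragmentations between models, which drives the
back and forth; completeness makes the starting points agree, and consistency gives existence. -/

namespace CovLogic

/-! ### Patterns of consolidations and quotients of contexts. -/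

namespace CoVal

variable {X Y Z M N : Type*}

/-- The identity co-valuation. -/
def id (X : Type*) : CoVal X X where
  rel x y := x = y
  cosurj a := ⟨a, rfl⟩
  coinj x := ⟨x, rfl, fun _ h => h⟩

@[simp] theorem id_rel (x y : X) : (id X).rel x y ↔ x = y := Iff.rfl

theorem consolidate_rel (g : CoVal X Y) (w : CoVal Y M) (x : X) (a : M) :
    (consolidate g w).rel x a ↔ ∃ y, g.rel x y ∧ w.rel y a := Iff.rfl

@[simp] theorem id_consolidate (v : CoVal X M) : consolidate (id X) v = v := by
  ext x a; simp [consolidate_rel]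

@[simp] theorem consolidate_id (v : CoVal X Y) : consolidate v (id Y) = v := by
  ext x a; simp [consolidate_rel]

theorem consolidate_assoc (f : CoVal X Y) (g : CoVal Y Z) (v : CoVal Z M) :
    consolidate (consolidate f g) v = consolidate f (consolidate g v) := by
  ext x a
  simp only [consolidate_rel]
  constructor
  · rintro ⟨z, ⟨y, h1, h2⟩, h3⟩; exact ⟨y, h1, z, h2, h3⟩
  · rintro ⟨y, h1, z, h2, h3⟩; exact ⟨z, ⟨y, h1, h2⟩, h3⟩

/-- The pattern of a consolidation is the inclusion relation between cells. -/
theorem rel_iff_cell_subset (g : CoVal X Y) (w : CoVal Y M) (x : X) (y : Y) :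
    g.rel x y ↔ w.cell y ⊆ (consolidate g w).cell x := by
  constructor
  · intro h a ha; exact ⟨y, h, ha⟩
  · intro h
    obtain ⟨a, ha, ha'⟩ := w.coinj y
    obtain ⟨y', h1, h2⟩ := h ha
    rwa [ha' y' h2] at h1

/-- Equations between co-valuations on a structure thereby become equations between patterns, finite
data that do not depend on the structure. -/
theorem consolidate_left_cancel {g g' : CoVal X Y} {w : CoVal Y M}
    (h : consolidate g w = consolidate g' w) : g = g' := by
  ext x y
  rw [rel_iff_cell_subset g w, h, ← rel_iff_cell_subset]

instance finite [Finite X] [Finite Y] : Finite (CoVal X Y) :=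
  Finite.of_injective CoVal.rel fun _ _ h => CoVal.ext h

/-- The co-valuation given by a surjective function. -/
def graph (s : Y → X) (hs : Function.Surjective s) : CoVal X Y where
  rel x y := s y = x
  cosurj y := ⟨s y, rfl⟩
  coinj x := by
    obtain ⟨y, rfl⟩ := hs x
    exact ⟨y, rfl, fun _ h => h.symm⟩

/-- A co-valuation that is invariant under the fibres of a surjection factors through it. -/
theorem exists_factor (s : Y → Z) (hs : Function.Surjective s) (α : CoVal X Y)
    (h : ∀ y y', s y = s y' → ∀ x, α.rel x y → α.rel x y') :
    ∃ β : CoVal X Z, (∀ x y, β.rel x (s y) ↔ α.rel x y) ∧ α = consolidate β (graph s hs) := by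
  have key : ∀ x y, (∃ y', s y' = s y ∧ α.rel x y') ↔ α.rel x y := fun x y =>
    ⟨fun ⟨y', h1, h2⟩ => h y' y h1 x h2, fun h2 => ⟨y, rfl, h2⟩⟩
  refine ⟨⟨fun x z => ∃ y, s y = z ∧ α.rel x y, fun z => ?_, fun x => ?_⟩, key, ?_⟩
  · obtain ⟨y, rfl⟩ := hs z
    obtain ⟨x, hx⟩ := α.cosurj y
    exact ⟨x, y, rfl, hx⟩
  · obtain ⟨y, hy, hy'⟩ := α.coinj x
    exact ⟨s y, ⟨y, rfl, hy⟩, fun x' hx' => hy' x' ((key x' y).1 hx')⟩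
  · ext x y
    constructor
    · intro hy; exact ⟨s y, ⟨y, rfl, hy⟩, rfl⟩
    · rintro ⟨z, hz, rfl⟩; exact (key x y).1 hz

/-- Every function from a context into a finite type has the same kernel as a surjection onto a
context `{0, …, k - 1}` of bounded size. -/
theorem exists_range_quotient {A : Type*} [Finite A] (f : Y → A) :
    ∃ k : Fin (Nat.card A + 1), ∃ s : Y → Finset.range k, Function.Surjective s ∧
      ∀ y y', s y = s y' ↔ f y = f y' := by
  have hk : Nat.card (Set.range f) < Nat.card A + 1 :=
    Nat.lt_succ_of_le (Finite.card_subtype_le _)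
  let e : Set.range f ≃ Finset.range (Nat.card (Set.range f)) :=
    (Finite.equivFin _).trans ((Finset.range _).equivFinOfCardEq (Finset.card_range _)).symm
  refine ⟨⟨_, hk⟩, fun y => e ⟨f y, Set.mem_range_self y⟩, fun z => ?_, fun y y' => ?_⟩
  · obtain ⟨⟨_, y, rfl⟩, rfl⟩ := e.surjective z
    exact ⟨y, rfl⟩
  · exact e.injective.eq_iff.trans Subtype.ext_iff

theorem rel_nonempty (g : CoVal X Y) [Nonempty Y] : Nonempty X :=
  ⟨(g.cosurj (Classical.arbitrary Y)).choose⟩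

/-- The co-valuation on a nonempty set in a one-point set. -/
def const (X Y : Type*) [Unique X] [Nonempty Y] : CoVal X Y where
  rel _ _ := True
  cosurj _ := ⟨default, trivial⟩
  coinj _ := ⟨Classical.arbitrary Y, trivial, fun _ _ => Subsingleton.elim _ _⟩

instance subsingleton [Subsingleton X] : Subsingleton (CoVal X M) where
  allEq v w := by
    have key : ∀ (v : CoVal X M) x a, v.rel x a := fun v x a => by
      obtain ⟨x', h⟩ := v.cosurj a
      rwa [Subsingleton.elim x x']
    ext x a
    simp [key]

end CoVal

/-! ### Size bounds in the structure axioms. -/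

namespace ProtoStructure

variable {L : FirstOrder.Language.{u, v}} {M : ProtoStructure.{u, v, w} L}

instance : Subsingleton {x // x ∈ star} :=
  ⟨fun a b => Subtype.ext ((Finset.mem_singleton.1 a.2).trans (Finset.mem_singleton.1 b.2).symm)⟩

instance : Unique {x // x ∈ star} := ⟨⟨⟨0, by simp⟩⟩, fun _ => Subsingleton.elim _ _⟩

open CoVal

theorem sat_rel {X : Context} {n : ℕ} {R : L.Relations n} {x : Fin n → X}
    {q : CoVal X M.carrier} : M.Sat (.rel R x) q ↔
      ∃ a : Fin n → M.carrier, (∀ k, a k ∈ q.cell (x k)) ∧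
        FirstOrder.Language.Structure.RelMap R a := Iff.rfl

theorem sat_ex {X Y : Context} {g : CoVal X Y} {φ : Formula L Y} {q : CoVal X M.carrier} :
    M.Sat (.ex g φ) q ↔ ∃ r ∈ M.V Y, q = consolidate g r ∧ M.Sat φ r := Iff.rfl

/-- Any two admissible co-valuations have a common fragmentation in a context of bounded size. -/
theorem IsStructure.exists_common (hM : M.IsStructure) {X Y : Context} {p : CoVal X M.carrier}
    {q : CoVal Y M.carrier} (hp : p ∈ M.V X) (hq : q ∈ M.V Y) :
    ∃ k : Fin (Nat.card (Set X × Set Y) + 1), ∃ α : CoVal X (Finset.range k),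
      ∃ β : CoVal Y (Finset.range k), ∃ r ∈ M.V (Finset.range k),
        consolidate α r = p ∧ consolidate β r = q := by
  obtain ⟨Z, r, hr, ⟨α, rfl⟩, ⟨β, rfl⟩⟩ := hM.directed X Y p hp q hq
  -- Indices below the same elements of `X` and of `Y` are merged. At most one class per pair of
  -- subsets remains, a bound independent of `M`.
  obtain ⟨k, s, hs, hs'⟩ := exists_range_quotient
    (fun z : Z => (({x | α.rel x z}, {y | β.rel y z}) : Set X × Set Y))
  simp only [Prod.mk.injEq, Set.ext_iff, Set.mem_ofPred_eq] at hs'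
  obtain ⟨α', -, hα⟩ := exists_factor s hs α fun y y' h x => (((hs' y y').1 h).1 x).1
  obtain ⟨β', -, hβ⟩ := exists_factor s hs β fun y y' h x => (((hs' y y').1 h).2 x).1
  refine ⟨k, α', β', consolidate (graph s hs) r, M.closed _ _ hr, ?_, ?_⟩
  · rw [← consolidate_assoc, ← hα]
  · rw [← consolidate_assoc, ← hβ]

/-- The witness axiom, with a witness in a context of bounded size. -/
theorem IsStructure.exists_witness (hM : M.IsStructure) {n : ℕ} {R : L.Relations n} {X : Context}
    {p : CoVal X M.carrier} (hp : p ∈ M.V X) {x : Fin n → X} (h : M.Sat (.rel R x) p) :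
    ∃ k : Fin (Nat.card (Set (Fin n)) + 1), ∃ q ∈ M.V (Finset.range k),
      ∃ (y : Fin n → Finset.range k) (a : Fin n → M.carrier),
        (∀ i, a i ∈ q.core (y i)) ∧ (∀ i, q.cell (y i) ⊆ p.cell (x i)) ∧
          FirstOrder.Language.Structure.RelMap R a := by
  obtain ⟨Y, q, hq, y, a, h1, h2, h3⟩ := hM.witness n R X p hp x h
  -- Merging by the set of coordinates that choose an index leaves each chosen index alone in its
  -- class, so the chosen cells do not grow and the `a i` stay in the cores.
  obtain ⟨k, s, hs, hs'⟩ := exists_range_quotient (fun z : Y => {i | y i = z})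
  have key : ∀ i z, s z = s (y i) → z = y i := fun i z hz =>
    ((Set.ext_iff.1 ((hs' _ _).1 hz) i).2 rfl).symm
  refine ⟨k, consolidate (graph s hs) q, M.closed _ _ hq, fun i => s (y i), a, fun i => ?_,
    fun i => ?_, h3⟩
  · refine ⟨⟨y i, rfl, (h1 i).1⟩, ?_⟩
    rintro _ ⟨z, rfl, hz⟩
    rw [(h1 i).2 z hz]
  · rintro b ⟨z, hz, hb⟩
    rw [key i z hz] at hb
    exact h2 i hb

end ProtoStructure

/-! ### Finite Boolean combinations, substitution, approximation of cores, countability. -/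

namespace Formula

open ProtoStructure (sat_rel)

variable {L : FirstOrder.Language.{u, v}} {X Y Z : Context}

open CoVal

/-- Finite conjunctions. -/
theorem exists_iInf {ι : Type*} [Finite ι] (f : ι → Formula L X) :
    ∃ φ : Formula L X, ∀ (M : ProtoStructure.{u, v, w} L) (q : CoVal X M.carrier),
      M.Sat φ q ↔ ∀ i, M.Sat (f i) q := by
  have : ∀ s : Set ι, s.Finite → ∃ φ : Formula L X, ∀ (M : ProtoStructure.{u, v, w} L)
      (q : CoVal X M.carrier), M.Sat φ q ↔ ∀ i ∈ s, M.Sat (f i) q := by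
    intro s hs
    induction s, hs using Set.Finite.induction_on with
    | empty => exact ⟨.neg .bot, fun M q => by simp [ProtoStructure.Sat]⟩
    | insert _ _ ih =>
      obtain ⟨φ, hφ⟩ := ih
      rename_i i s _ _
      exact ⟨.and (f i) φ, fun M q => by simp [ProtoStructure.Sat, hφ]⟩
  obtain ⟨φ, hφ⟩ := this Set.univ Set.finite_univ
  exact ⟨φ, fun M q => by simp [hφ]⟩

/-- Finite disjunctions. -/
theorem exists_iSup {ι : Type*} [Finite ι] (f : ι → Formula L X) :
    ∃ φ : Formula L X, ∀ (M : ProtoStructure.{u, v, w} L) (q : CoVal X M.carrier),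
      M.Sat φ q ↔ ∃ i, M.Sat (f i) q := by
  obtain ⟨φ, hφ⟩ := exists_iInf.{u, v, w} fun i => (f i).neg
  exact ⟨.neg φ, fun M q => by simp [ProtoStructure.Sat, hφ]⟩

/-- Satisfaction of a formula at a consolidation is expressed by a formula. -/
theorem exists_subst {X : Context} (φ : Formula L X) : ∀ {Z : Context} (h : CoVal X Z),
    ∃ φ' : Formula L Z, ∀ M : ProtoStructure.{u, v, w} L, M.IsStructure → ∀ q ∈ M.V Z,
      (M.Sat φ' q ↔ M.Sat φ (consolidate h q)) := by
  induction φ with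
  | bot => exact fun h => ⟨.bot, fun M _ q _ => Iff.rfl⟩
  | @rel X n R x =>
    intro Z h
    obtain ⟨φ', h'⟩ := exists_iSup.{u, v, w}
      fun z : {z : Fin n → Z // ∀ k, h.rel (x k) (z k)} => Formula.rel R z.1
    refine ⟨φ', fun M hM q hq => ?_⟩
    rw [h']
    constructor
    · rintro ⟨⟨z, hz⟩, a, h1, h2⟩
      exact ⟨a, fun k => ⟨z k, hz k, h1 k⟩, h2⟩
    · rintro ⟨a, h1, h2⟩
      choose z hz hz' using h1
      exact ⟨⟨z, hz⟩, a, hz', h2⟩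
  | neg φ ih =>
    intro Z h
    obtain ⟨φ', h'⟩ := ih h
    exact ⟨.neg φ', fun M hM q hq => not_congr (h' M hM q hq)⟩
  | and φ ψ ih1 ih2 =>
    intro Z h
    obtain ⟨φ', h1⟩ := ih1 h
    obtain ⟨ψ', h2⟩ := ih2 h
    exact ⟨.and φ' ψ', fun M hM q hq => and_congr (h1 M hM q hq) (h2 M hM q hq)⟩
  | @ex X Y g φ ih =>
    intro Z h
    choose φ' h' using @ih
    -- The witness `p` for `φ` and the given `q` are unrelated beyond having a common consolidation,
    -- so a common fragmentation is quantified instead. Bounded size leaves finitely many pairs of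
    -- patterns, and the equation on patterns encodes that `p` and `q` consolidate to the same
    -- co-valuation.
    obtain ⟨θ, hθ⟩ := exists_iSup.{u, v, w}
      fun c : {c : Σ k : Fin (Nat.card (Set Z × Set Y) + 1),
        CoVal Z (Finset.range k) × CoVal Y (Finset.range k) //
          consolidate h c.2.1 = consolidate g c.2.2} => Formula.ex c.1.2.1 (φ' c.1.2.2)
    refine ⟨θ, fun M hM q hq => ?_⟩
    rw [hθ]
    constructor
    · rintro ⟨⟨⟨k, α, β⟩, hc⟩, r, hr, rfl, hs⟩
      refine ⟨consolidate β r, M.closed _ _ hr, ?_, (h' β M hM r hr).1 hs⟩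
      rw [← consolidate_assoc, ← consolidate_assoc]
      exact congrArg (consolidate · r) hc
    · rintro ⟨p, hp, h1, h2⟩
      obtain ⟨k, α, β, r, hr, rfl, rfl⟩ := hM.exists_common hq hp
      rw [← consolidate_assoc, ← consolidate_assoc] at h1
      exact ⟨⟨⟨k, α, β⟩, consolidate_left_cancel h1⟩, r, hr, rfl, (h' β M hM r hr).2 h2⟩

/-- For admissible `q`, a formula that holds if `R` meets the product of the cores of the cells
`[y k]_q`, and that implies this approximately, in all fragmentations. -/
theorem exists_core {n : ℕ} (R : L.Relations n) (y : Fin n → Y) :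
    ∃ χ : Formula L Y, ∀ M : ProtoStructure.{u, v, w} L,
      (∀ q ∈ M.V Y, (∃ a : Fin n → M.carrier, (∀ k, a k ∈ q.core (y k)) ∧
        FirstOrder.Language.Structure.RelMap R a) → M.Sat χ q) ∧
      ∀ (Z : Context) (h : CoVal Y Z), ∀ r ∈ M.V Z, M.Sat χ (consolidate h r) →
        ∃ z : Fin n → Z, (∀ k, z k ∈ h.core (y k)) ∧ M.Sat (.rel R z) r := by
  have h1 : ∀ c : Σ k : Fin (Nat.card (Set Y) + 1), CoVal Y (Finset.range k), ∃ φ : Formula L _,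
      ∀ (M : ProtoStructure.{u, v, w} L) (q : CoVal _ M.carrier), M.Sat φ q ↔
        ∃ z : {z : Fin n → Finset.range c.1 // ∀ k, z k ∈ c.2.core (y k)}, M.Sat (.rel R z.1) q :=
    fun c => exists_iSup.{u, v, w} _
  choose φ hφ using h1
  -- In place of points in cores, `χ` asks that in every fragmentation of bounded size `R` holds at
  -- a tuple of indices lying in the cores of the pattern at `y`.
  obtain ⟨χ, hχ⟩ := exists_iInf.{u, v, w} fun c => Formula.neg (.ex c.2 (.neg (φ c)))
  simp only [ProtoStructure.Sat, not_exists, not_and, not_not] at hχ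
  refine ⟨χ, fun M => ⟨?_, ?_⟩⟩
  · rintro q hq ⟨a, ha, hR⟩
    rw [hχ]
    rintro c r hr rfl
    rw [hφ]
    choose z hz hz' using fun k => (ha k).1
    refine ⟨⟨z, fun k => ⟨hz k, fun y' hy' => ?_⟩⟩, ?_⟩
    swap
    · exact sat_rel.2 ⟨a, hz', hR⟩
    exact (ha k).2 y' ⟨z k, hy', hz' k⟩
  · intro Z h r hr hs
    -- Merging indices that lie below the same elements brings an arbitrary context under the bound,
    -- and cores of `h` are unions of merged classes.
    obtain ⟨k, s, hs1, hs2⟩ := exists_range_quotient (fun z : Z => {x | h.rel x z})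
    simp only [Set.ext_iff, Set.mem_ofPred_eq] at hs2
    obtain ⟨h', hh', hh⟩ := exists_factor s hs1 h fun y y' h x => ((hs2 y y').1 h x).1
    have h3 := (hχ M _).1 hs ⟨k, h'⟩ (consolidate (graph s hs1) r) (M.closed _ _ hr)
      (by rw [← consolidate_assoc, ← hh])
    obtain ⟨⟨z', hz'⟩, a, ha, hR⟩ := (hφ _ _ _).1 h3
    choose z hz hza using ha
    refine ⟨z, fun i => ⟨?_, fun y' hy' => ?_⟩, a, hza, hR⟩
    · rw [← hh', show s (z i) = z' i from hz i]
      exact (hz' i).1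
    · rw [← hh', show s (z i) = z' i from hz i] at hy'
      exact (hz' i).2 y' hy'

/-- The nesting depth of a formula. -/
def depth : {X : Context} → Formula L X → ℕ
  | _, .bot => 0
  | _, .rel _ _ => 0
  | _, .neg φ => φ.depth + 1
  | _, .and φ ψ => max φ.depth ψ.depth + 1
  | _, .ex _ φ => φ.depth + 1

/-- The contexts vary along subformulas, so the induction is on depth, over all contexts at once. -/
instance countable [Countable (Σ n, L.Relations n)] (X : Context) : Countable (Formula L X) := by
  have key : ∀ n, ∀ X : Context, {φ : Formula L X | φ.depth < n}.Countable := by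
    intro n
    induction n with
    | zero => intro X; simp
    | succ n ih =>
      intro X
      have hL : ∀ n, Countable (L.Relations n) := fun n =>
        (sigma_mk_injective (β := fun n => L.Relations n) (i := n)).countable
      refine Set.Countable.mono (s₂ := {.bot} ∪
        Set.range (fun c : Σ n, L.Relations n × (Fin n → X) => Formula.rel c.2.1 c.2.2) ∪
        Formula.neg '' {φ : Formula L X | φ.depth < n} ∪
        Set.image2 Formula.and {φ : Formula L X | φ.depth < n} {φ : Formula L X | φ.depth < n} ∪
        ⋃ c : Σ Y : Context, CoVal X Y, Formula.ex c.2 '' {φ : Formula L c.1 | φ.depth < n}) ?_ ?_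
      · intro φ hφ
        cases φ with
        | bot => simp
        | rel R x => exact .inl (.inl (.inl (.inr ⟨⟨_, R, x⟩, rfl⟩)))
        | neg φ => exact .inl (.inl (.inr ⟨φ, Nat.lt_of_succ_lt_succ hφ, rfl⟩))
        | and φ ψ =>
          have := max_lt_iff.1 (Nat.lt_of_succ_lt_succ hφ)
          exact .inl (.inr ⟨φ, this.1, ψ, this.2, rfl⟩)
        | ex g φ =>
          exact .inr (Set.mem_iUnion.2 ⟨⟨_, g⟩, φ, Nat.lt_of_succ_lt_succ hφ, rfl⟩)
      · exact ((((Set.countable_singleton _).union (Set.countable_range _)).union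
          ((ih X).image _)).union ((ih X).image2 (ih X) _)).union
            (Set.countable_iUnion fun c => (ih c.1).image _)
  rw [← Set.countable_univ_iff]
  refine (Set.countable_iUnion fun n => key n X).mono fun φ _ => ?_
  exact Set.mem_iUnion.2 ⟨φ.depth + 1, Nat.lt_succ_self _⟩

end Formula

end CovLogic

/-! ### Limits of towers and the structures carried by them. -/

namespace CovLogic

open CoVal

/-- An inverse sequence of contexts and co-valuations. -/
structure Tower where
  X : ℕ → Context
  g : ∀ {i j : ℕ}, i ≤ j → CoVal (X i) (X j)
  g_self : ∀ i, g (le_refl i) = CoVal.id _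
  g_comp : ∀ {i j k : ℕ} (hij : i ≤ j) (hjk : j ≤ k),
    consolidate (g hij) (g hjk) = g (hij.trans hjk)
  nonempty : ∀ i, Nonempty (X i)

attribute [instance] Tower.nonempty

namespace Tower

/-- The tower generated by its one-step co-valuations. -/
abbrev ofSucc (X : ℕ → Context) (s : ∀ i, CoVal (X i) (X (i + 1))) (hX : ∀ i, Nonempty (X i)) :
    Tower where
  X := X
  g {i _} h := Nat.leRecOn h (C := fun j => CoVal (X i) (X j))
    (fun {k} c => consolidate c (s k)) (CoVal.id _)
  g_self i := Nat.leRecOn_self _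
  g_comp {i j k} hij hjk := by
    induction k, hjk using Nat.le_induction with
    | base => rw [Nat.leRecOn_self, consolidate_id]
    | succ k hjk ih =>
      rw [Nat.leRecOn_succ hjk, Nat.leRecOn_succ (hij.trans hjk), ← consolidate_assoc, ih]
  nonempty := hX

theorem ofSucc_g_step (X : ℕ → Context) (s : ∀ i, CoVal (X i) (X (i + 1)))
    (hX : ∀ i, Nonempty (X i)) {i j : ℕ} (h : i ≤ j) :
    (ofSucc X s hX).g (h.trans (Nat.le_succ j)) = consolidate ((ofSucc X s hX).g h) (s j) := by
  exact Nat.leRecOn_succ h _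

variable (τ : Tower)

/-- Selectors: up-closed families that meet every level. -/
def IsSelector (S : ∀ i, Set (τ.X i)) : Prop :=
  (∀ i j (h : i ≤ j) x y, (τ.g h).rel x y → y ∈ S j → x ∈ S i) ∧ ∀ i, (S i).Nonempty

variable {τ}

/-- Zorn for reverse inclusion. A chain has a selector as its intersection because levels are
finite: if each element of a level were dropped by some member, the smallest of these finitely many
members would miss the level. -/
theorem exists_minimal_selector {S : ∀ i, Set (τ.X i)} (hS : τ.IsSelector S) :
    ∃ T ≤ S, Minimal τ.IsSelector T := by
  have H : ∀ c ⊆ {T : (∀ i, Set (τ.X i))ᵒᵈ | τ.IsSelector (OrderDual.ofDual T)},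
      IsChain (· ≤ ·) c → ∀ T₀ ∈ c, ∃ ub ∈ {T : (∀ i, Set (τ.X i))ᵒᵈ |
        τ.IsSelector (OrderDual.ofDual T)}, ∀ T ∈ c, T ≤ ub := by
    intro c hc hchain T₀ hT₀
    refine ⟨OrderDual.toDual fun i => {x | ∀ T ∈ c, x ∈ (OrderDual.ofDual T) i},
      ⟨?_, fun i => ?_⟩, fun T hT i x hx => hx T hT⟩
    · intro i j h x y hxy hy T hT
      exact (hc hT).1 i j h x y hxy (hy T hT)
    · by_contra hne
      have h1 : ∀ x : τ.X i, ∃ T ∈ c, x ∉ (OrderDual.ofDual T) i := by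
        intro x
        by_contra! hx
        exact hne ⟨x, hx⟩
      choose F hF hF' using h1
      obtain ⟨m, ⟨x₀, rfl⟩, hm⟩ :=
        (Set.finite_range F).exists_maximal (Set.range_nonempty F)
      obtain ⟨y, hy⟩ := (hc (hF x₀)).2 i
      have hy' : F y ≤ F x₀ := (hchain.total (hF y) (hF x₀)).elim (fun h => h)
        (fun h => hm ⟨y, rfl⟩ h)
      exact hF' y (hy' i hy)
  obtain ⟨T, hT, hmin⟩ := zorn_le_nonempty₀ _ H (OrderDual.toDual S) hS
  exact ⟨OrderDual.ofDual T, hT, hmin.1, fun T' h h' => hmin.2 h h'⟩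

/-- Below every element of a minimal selector there is a level all of whose selected elements lie
below it. -/
theorem exists_forall_rel_of_minimal {S : ∀ i, Set (τ.X i)} (hS : Minimal τ.IsSelector S) {i : ℕ}
    {x : τ.X i} (hx : x ∈ S i) :
    ∃ j, ∃ h : i ≤ j, ∀ y ∈ S j, (τ.g h).rel x y := by
  by_contra! hne
  -- `T` collects what lies above selected elements that are not below `x`. It is a selector inside
  -- `S`, so minimality puts `x` above an element that is not below it.
  let T : ∀ k, Set (τ.X k) := fun k => {z | ∃ j, ∃ h : i ≤ j, ∃ hk : k ≤ j, ∃ y ∈ S j,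
    ¬ (τ.g h).rel x y ∧ (τ.g hk).rel z y}
  have hT : τ.IsSelector T := by
    constructor
    · rintro k l hkl z z' hz ⟨j, h, hk, y, hy, hxy, hzy⟩
      exact ⟨j, h, hkl.trans hk, y, hy, hxy, by rw [← τ.g_comp hkl hk]; exact ⟨z', hz, hzy⟩⟩
    · intro k
      obtain ⟨y, hy, hxy⟩ := hne (max i k) (le_max_left _ _)
      obtain ⟨z, hz⟩ := (τ.g (le_max_right i k)).cosurj y
      exact ⟨z, _, _, _, y, hy, hxy, hz⟩
  have hTS : T ≤ S := by
    rintro k z ⟨j, h, hk, y, hy, hxy, hzy⟩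
    exact hS.1.1 _ _ hk _ _ hzy hy
  obtain ⟨j, h, hk, y, hy, hxy, hzy⟩ := hS.2 hT hTS i hx
  exact hxy hzy

theorem IsSelector.rel_of_le {S : ∀ i, Set (τ.X i)} (hS : τ.IsSelector S) {i j : ℕ} (h : i ≤ j)
    {x : τ.X i} (hx : ∀ y ∈ S j, (τ.g h).rel x y) : ∀ {k : ℕ} (hk : j ≤ k), ∀ y ∈ S k,
      (τ.g (h.trans hk)).rel x y := by
  intro k hk y hy
  obtain ⟨z, hz⟩ := (τ.g hk).cosurj y
  rw [← τ.g_comp h hk]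
  exact ⟨z, hx z (hS.1 _ _ hk _ _ hz hy), hz⟩

variable (τ)

/-- The points of the limit of a tower are its minimal selectors. -/
abbrev Point := {S : ∀ i, Set (τ.X i) // Minimal τ.IsSelector S}

variable {τ}

open Filter in
/-- Every family of sequences of elements of increasing levels accumulates at a family of
selectors. -/
theorem exists_selector_of_seq {ι : Type*} (j : ℕ) (z : ∀ n, ι → τ.X (j + n)) :
    ∃ S : ι → ∀ i, Set (τ.X i), (∀ k, τ.IsSelector (S k)) ∧ ∀ k i, ∀ x ∈ S k i,
      ∀ᶠ n in (hyperfilter ℕ : Filter ℕ), ∃ h : i ≤ j + n, (τ.g h).rel x (z n k) := by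
  -- An ultralimit: select what lies above the sequence for almost all `n`. Since levels are finite,
  -- the ultrafilter singles out an element of each.
  refine ⟨fun k i => {x | ∀ᶠ n in (hyperfilter ℕ : Filter ℕ), ∃ h : i ≤ j + n,
    (τ.g h).rel x (z n k)}, fun k => ⟨fun i l hil x y hxy hy => ?_, fun i => ?_⟩,
    fun k i x hx => hx⟩
  · refine Eventually.mono hy ?_
    rintro n ⟨h, hn⟩
    exact ⟨hil.trans h, by rw [← τ.g_comp hil h]; exact ⟨y, hxy, hn⟩⟩
  · have h1 : ∀ᶠ n in (hyperfilter ℕ : Filter ℕ), ∃ x, ∃ h : i ≤ j + n,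
        (τ.g h).rel x (z n k) := by
      have h2 : ∀ᶠ n in (hyperfilter ℕ : Filter ℕ), i ≤ n :=
        Nat.hyperfilter_le_atTop (eventually_ge_atTop i)
      filter_upwards [h2] with n hn
      obtain ⟨x, hx⟩ := (τ.g (hn.trans (Nat.le_add_left n j))).cosurj (z n k)
      exact ⟨x, _, hx⟩
    exact Ultrafilter.eventually_exists_iff.1 h1

/-- Each level beyond `i` has an element below `x` and nothing else of level `i`. A selector
accumulated by such elements has only `x` at level `i`. -/
theorem exists_point_core (i : ℕ) (x : τ.X i) : ∃ p : τ.Point, ∀ y, y ∈ p.1 i ↔ y = x := by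
  choose z hz using fun n => (τ.g (Nat.le_add_right i n)).coinj x
  obtain ⟨S, hS, hS'⟩ := exists_selector_of_seq (τ := τ) (ι := Unit) i fun n _ => z n
  obtain ⟨T, hT, hmin⟩ := exists_minimal_selector (hS ())
  have key : ∀ y ∈ T i, y = x := fun y hy => by
    obtain ⟨n, h, hn⟩ := (hS' () i y (hT i hy)).exists
    exact (hz n).2 y hn
  refine ⟨⟨T, hmin⟩, fun y => ⟨key y, ?_⟩⟩
  rintro rfl
  obtain ⟨y', hy'⟩ := hmin.1.2 i
  exact key y' hy' ▸ hy'

variable (τ) in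
/-- The co-valuation on the limit of a tower given by one of its levels. -/
def proj (i : ℕ) : CoVal (τ.X i) (ULift.{w} τ.Point) where
  rel x p := x ∈ p.down.1 i
  cosurj p := p.down.2.1.2 i
  coinj x := by
    obtain ⟨p, hp⟩ := exists_point_core i x
    exact ⟨⟨p⟩, (hp x).2 rfl, fun y hy => (hp y).1 hy⟩

/-- Minimality is what makes a point in the cell of `x` lie in a finer cell below `x`: at some late
level all its cells are below `x`, and one of them factors through level `j`. -/
theorem consolidate_proj {i j : ℕ} (h : i ≤ j) : consolidate (τ.g h) (proj.{w} τ j) = τ.proj i := by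
  ext x p
  constructor
  · rintro ⟨y, hxy, hy⟩
    exact p.down.2.1.1 i j h x y hxy hy
  · intro hx
    obtain ⟨k, hik, hk⟩ := exists_forall_rel_of_minimal p.down.2 hx
    obtain ⟨z, hz⟩ := p.down.2.1.2 (max j k)
    have h1 := p.down.2.1.rel_of_le hik hk (le_max_right j k) z hz
    have h2 := τ.g_comp h (le_max_left j k)
    rw [← h2] at h1
    obtain ⟨y, hxy, hyz⟩ := h1
    exact ⟨y, hxy, p.down.2.1.1 _ _ _ y z hyz hz⟩

variable {L : FirstOrder.Language.{u, v}}

/-- A consistent assignment of truth values to formulas at the consolidations of the levels of a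
tower, with witnesses for quantifiers and for the cells in which a relation holds. -/
structure Valuation (τ : Tower) (L : FirstOrder.Language.{u, v}) where
  P : ∀ {i : ℕ} {Y : Context}, CoVal Y (τ.X i) → Formula L Y → Prop
  bot : ∀ {i : ℕ} {Y : Context} (h : CoVal Y (τ.X i)), ¬ P h .bot
  neg : ∀ {i : ℕ} {Y : Context} (h : CoVal Y (τ.X i)) φ, P h (.neg φ) ↔ ¬ P h φ
  and : ∀ {i : ℕ} {Y : Context} (h : CoVal Y (τ.X i)) φ ψ, P h (.and φ ψ) ↔ P h φ ∧ P h ψ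
  ex : ∀ {i : ℕ} {Y Z : Context} (h : CoVal Y (τ.X i)) (g : CoVal Y Z) φ, P h (.ex g φ) ↔
    ∃ j, ∃ hij : i ≤ j, ∃ h' : CoVal Z (τ.X j),
      consolidate g h' = consolidate h (τ.g hij) ∧ P h' φ
  rel : ∀ {i : ℕ} {Y : Context} (h : CoVal Y (τ.X i)) {n : ℕ} (R : L.Relations n) (x : Fin n → Y),
    P h (.rel R x) ↔ ∃ z, (∀ k, h.rel (x k) (z k)) ∧ P (CoVal.id (τ.X i)) (.rel R z)
  mono : ∀ {i j : ℕ} (hij : i ≤ j) {Y : Context} (h : CoVal Y (τ.X i)) φ,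
    P h φ ↔ P (consolidate h (τ.g hij)) φ
  witness : ∀ {i n : ℕ} (R : L.Relations n) (x : Fin n → τ.X i),
    P (CoVal.id (τ.X i)) (.rel R x) → ∃ j, ∃ hij : i ≤ j, ∃ Y : Context, ∃ q : CoVal Y (τ.X j),
      ∃ y : Fin n → Y, (∀ k z, q.rel (y k) z → (τ.g hij).rel (x k) z) ∧
        ∀ l (hjl : j ≤ l), ∃ z, (∀ k, z k ∈ (consolidate q (τ.g hjl)).core (y k)) ∧
          P (CoVal.id (τ.X l)) (.rel R z)

namespace Valuation

variable (P : Valuation τ L)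

theorem rel_mono {i j : ℕ} (hij : i ≤ j) {n : ℕ} {R : L.Relations n} {x : Fin n → τ.X i}
    {y : Fin n → τ.X j} (hxy : ∀ k, (τ.g hij).rel (x k) (y k))
    (h : P.P (CoVal.id _) (.rel R y)) : P.P (CoVal.id _) (.rel R x) := by
  rw [P.mono hij, id_consolidate, P.rel]
  exact ⟨y, hxy, h⟩

variable [L.IsRelational]

/-- The limit of a tower with a valuation. -/
abbrev model : ProtoStructure.{u, v, w} L where
  carrier := ULift.{w} τ.Point
  nonempty := by
    obtain ⟨p, -⟩ := exists_point_core (τ := τ) 0 (Classical.arbitrary _)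
    exact ⟨⟨p⟩⟩
  str :=
    { funMap := fun f => isEmptyElim f
      RelMap := fun {n} R a => ∀ i (x : Fin n → τ.X i), (∀ k, x k ∈ (a k).down.1 i) →
        P.P (CoVal.id _) (.rel R x) }
  V Y := {q | ∃ i, ∃ h : CoVal Y (τ.X i), q = consolidate h (τ.proj i)}
  closed := by
    rintro X Y g _ ⟨i, h, rfl⟩
    exact ⟨i, consolidate g h, (consolidate_assoc _ _ _).symm⟩

theorem proj_mem (i : ℕ) : τ.proj i ∈ P.model.V (τ.X i) := ⟨i, CoVal.id _, by simp⟩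

theorem mem_model_ge {Y : Context} {q : CoVal Y P.model.carrier} (hq : q ∈ P.model.V Y) (i : ℕ) :
    ∃ j, ∃ _ : i ≤ j, ∃ h : CoVal Y (τ.X j), q = consolidate h (τ.proj j) := by
  obtain ⟨j, h, rfl⟩ := hq
  refine ⟨max i j, le_max_left _ _, consolidate h (τ.g (le_max_right i j)), ?_⟩
  rw [consolidate_assoc, consolidate_proj]

theorem relMap_iff {n : ℕ} {R : L.Relations n} {a : Fin n → P.model.carrier} :
    P.model.str.RelMap R a ↔ ∀ i (x : Fin n → τ.X i),
      (∀ k, x k ∈ (a k).down.1 i) → P.P (CoVal.id _) (.rel R x) := Iff.rfl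

/-- The points are minimal selectors inside the ultralimits of the tuples that `witness` provides at
all late levels. These tuples lie in the cores at `y`, and any cells around the points are above one
of them, where `R` is true. -/
theorem exists_core_tuple {i n : ℕ} {R : L.Relations n} {x : Fin n → τ.X i}
    (h : P.P (CoVal.id (τ.X i)) (.rel R x)) :
    ∃ (Y : Context) (q : CoVal Y P.model.carrier) (_ : q ∈ P.model.V Y) (y : Fin n → Y)
      (a : Fin n → P.model.carrier), (∀ k, a k ∈ q.core (y k)) ∧
        (∀ k, q.cell (y k) ⊆ (proj.{w} τ i).cell (x k)) ∧
          P.model.str.RelMap R a := by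
  obtain ⟨j, hij, Y, q, y, h1, h2⟩ := P.witness R x h
  choose z hz hz' using fun m => h2 (j + m) (Nat.le_add_right j m)
  obtain ⟨S, hS, hS'⟩ := exists_selector_of_seq (τ := τ) j z
  choose T hT hmin using fun k => exists_minimal_selector (hS k)
  refine ⟨Y, consolidate q (τ.proj j), ⟨j, q, rfl⟩, y, fun k => ⟨⟨T k, hmin k⟩⟩,
    fun k => ?_, fun k => ?_, ?_⟩
  · have key : ∀ t ∈ T k j, ∀ y', q.rel y' t → y' = y k := by
      intro t ht y' hy'
      obtain ⟨m, hm, hm'⟩ := (hS' k j t (hT k j ht)).exists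
      exact (hz m k).2 y' ⟨t, hy', hm'⟩
    refine ⟨?_, fun y' ⟨t, h3, h4⟩ => key t h4 y' h3⟩
    obtain ⟨t, ht⟩ := (hmin k).1.2 j
    obtain ⟨y', hy'⟩ := q.cosurj t
    exact ⟨t, key t ht y' hy' ▸ hy', ht⟩
  · rintro p ⟨t, ht, ht'⟩
    exact p.down.2.1.1 _ _ hij _ t (h1 k t ht) ht'
  · refine P.relMap_iff.2 fun l t ht => ?_
    obtain ⟨m, hm, hlm⟩ := ((Filter.eventually_all.2 fun k => hS' k l (t k) (hT k l (ht k))).and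
      (Nat.hyperfilter_le_atTop (Filter.eventually_ge_atTop l))).exists
    exact P.rel_mono (hlm.trans (Nat.le_add_left m j)) (fun k => (hm k).2) (hz' m)

/-- The truth lemma. In the atomic case `exists_core_tuple` supplies actual points; in the
quantifier case admissible co-valuations are moved to a later level and patterns are compared by
cancellation. -/
theorem sat_iff {Y : Context} (φ : Formula L Y) : ∀ {i : ℕ} (h : CoVal Y (τ.X i)),
    P.model.Sat φ (consolidate h (proj.{w} τ i)) ↔ P.P h φ := by
  induction φ with
  | bot => exact fun h => iff_of_false (fun h => h) (P.bot h)
  | @rel Y n R x =>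
    intro i h
    rw [P.rel]
    constructor
    · rintro ⟨a, h1, hR⟩
      choose z hz hz' using h1
      exact ⟨z, hz, P.relMap_iff.1 hR i z hz'⟩
    · rintro ⟨z, hz, hR⟩
      obtain ⟨_, q, _, y, a, h1, h2, h3⟩ := P.exists_core_tuple hR
      exact ⟨a, fun k => ⟨z k, hz k, h2 k (h1 k).1⟩, h3⟩
  | neg φ ih => exact fun h => (not_congr (ih h)).trans (P.neg h φ).symm
  | and φ ψ ih1 ih2 => exact fun h => (and_congr (ih1 h) (ih2 h)).trans (P.and h φ ψ).symm
  | @ex Y Z g φ ih =>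
    intro i h
    rw [P.ex]
    constructor
    · rintro ⟨q, hq, hgq, hs⟩
      obtain ⟨j, hij, h', rfl⟩ := P.mem_model_ge hq i
      refine ⟨j, hij, h', ?_, (ih h').1 hs⟩
      rw [← consolidate_proj hij, ← consolidate_assoc, ← consolidate_assoc] at hgq
      exact (consolidate_left_cancel hgq).symm
    · rintro ⟨j, hij, h', hgh, hs⟩
      refine ⟨consolidate h' (τ.proj j), ⟨j, h', rfl⟩, ?_, (ih h').2 hs⟩
      rw [← consolidate_proj hij, ← consolidate_assoc, ← consolidate_assoc, hgh]

theorem isStructure_model : (P.model : ProtoStructure.{u, v, w} L).IsStructure where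
  nonempty_V := ⟨_, _, P.proj_mem 0⟩
  directed X Y p hp q hq := by
    obtain ⟨i, h, rfl⟩ := hp
    obtain ⟨j, hij, h', rfl⟩ := P.mem_model_ge hq i
    refine ⟨_, _, P.proj_mem j, ⟨consolidate h (τ.g hij), ?_⟩, ⟨h', rfl⟩⟩
    rw [consolidate_assoc, consolidate_proj]
  witness n R X p hp x hx := by
    obtain ⟨i, h, rfl⟩ := hp
    obtain ⟨z, hz, hR⟩ := (P.rel h R x).1 ((P.sat_iff _ h).1 hx)
    obtain ⟨Y, q, hq, y, a, h1, h2, h3⟩ := P.exists_core_tuple hR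
    exact ⟨Y, q, hq, y, a, h1, fun k p hp => ⟨z k, hz k, h2 k hp⟩, h3⟩

theorem isOmega_model : (P.model : ProtoStructure.{u, v, w} L).IsOmega := by
  refine ⟨τ.X, τ.proj, P.proj_mem, fun i => ⟨τ.g (Nat.le_succ i), ?_⟩, ?_⟩
  · rw [consolidate_proj]
  · rintro Y _ ⟨i, h, rfl⟩
    exact ⟨i, h, rfl⟩

end Valuation

variable (τ) in
/-- The topology of the limit of a tower, in which the cells are basic open sets. -/
abbrev topology : TopologicalSpace (ULift.{w} τ.Point) where
  IsOpen U := ∀ p ∈ U, ∃ i, ∃ x ∈ p.down.1 i, (τ.proj i).cell x ⊆ U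
  isOpen_univ p _ := by
    obtain ⟨x, hx⟩ := p.down.2.1.2 0
    exact ⟨0, x, hx, Set.subset_univ _⟩
  isOpen_inter U U' hU hU' p hp := by
    obtain ⟨i, x, hx, hxU⟩ := hU p hp.1
    obtain ⟨i', x', hx', hxU'⟩ := hU' p hp.2
    obtain ⟨j, hij, hj⟩ := exists_forall_rel_of_minimal p.down.2 hx
    obtain ⟨j', hij', hj'⟩ := exists_forall_rel_of_minimal p.down.2 hx'
    obtain ⟨z, hz⟩ := p.down.2.1.2 (max j j')
    refine ⟨_, z, hz, fun q hq => ⟨hxU ?_, hxU' ?_⟩⟩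
    · exact q.down.2.1.1 _ _ _ _ z
        (p.down.2.1.rel_of_le hij hj (le_max_left _ _) z hz) hq
    · exact q.down.2.1.1 _ _ _ _ z
        (p.down.2.1.rel_of_le hij' hj' (le_max_right _ _) z hz) hq
  isOpen_sUnion 𝒰 h𝒰 p hp := by
    obtain ⟨U, hU, hpU⟩ := hp
    obtain ⟨i, x, hx, hxU⟩ := h𝒰 U hU p hpU
    exact ⟨i, x, hx, hxU.trans (Set.subset_sUnion_of_mem hU)⟩

/-- Otherwise the cells contained in no member of the cover form a selector, and a point inside this
selector has no member of the cover as a neighbourhood. -/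
theorem exists_level_refining {𝒰 : Set (Set (ULift.{w} τ.Point))}
    (h𝒰 : ∀ U ∈ 𝒰, (τ.topology).IsOpen U) (hcov : ⋃₀ 𝒰 = Set.univ) :
    ∃ i, ∀ x, ∃ U ∈ 𝒰, (τ.proj i).cell x ⊆ U := by
  by_contra! hne
  have hS : τ.IsSelector fun i => {x | ∀ U ∈ 𝒰, ¬ (proj.{w} τ i).cell x ⊆ U} := by
    refine ⟨fun i j h x y hxy hy U hU hsub => hy U hU fun p hp => hsub ?_, hne⟩
    exact p.down.2.1.1 i j h x y hxy hp
  obtain ⟨T, hT, hmin⟩ := exists_minimal_selector hS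
  obtain ⟨U, hU, hTU⟩ := Set.mem_sUnion.1 (hcov ▸ Set.mem_univ (⟨⟨T, hmin⟩⟩ : ULift.{w} τ.Point))
  obtain ⟨i, x, hx, hxU⟩ := h𝒰 U hU _ hTU
  exact hT i hx U hU hxU

theorem isOpen_cell (i : ℕ) (x : τ.X i) : (topology.{w} τ).IsOpen ((τ.proj i).cell x) :=
  fun _ hp => ⟨i, x, hp, subset_rfl⟩

namespace Valuation

variable [L.IsRelational] (P : Valuation τ L)

theorem isCompact_model : (P.model : ProtoStructure.{u, v, w} L).IsCompact := by
  let _ : TopologicalSpace (ULift.{w} τ.Point) := τ.topology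
  have hopen : ∀ i (x : τ.X i), IsOpen ((proj.{w} τ i).cell x) := isOpen_cell
  refine ⟨τ.topology, ⟨?_⟩, ⟨fun p => ?_⟩, ?_, ?_, ?_⟩
  · refine isCompact_of_finite_subcover fun {ι} U hU hcov => ?_
    obtain ⟨i, hi⟩ := exists_level_refining (𝒰 := Set.range U) (τ := τ)
      (by rintro _ ⟨k, rfl⟩; exact hU k) (by
        rw [Set.sUnion_range]; exact Set.univ_subset_iff.1 hcov)
    have hi' : ∀ x, ∃ k, (proj.{w} τ i).cell x ⊆ U k := fun x => by
      obtain ⟨_, ⟨k, rfl⟩, hk⟩ := hi x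
      exact ⟨k, hk⟩
    choose k hk using hi'
    classical
    refine ⟨Finset.univ.image k, fun p _ => ?_⟩
    obtain ⟨x, hx⟩ := (τ.proj i).cosurj p
    exact Set.mem_iUnion₂.2 ⟨k x, Finset.mem_image_of_mem _ (Finset.mem_univ _), hk x hx⟩
  · rw [← isOpen_compl_iff]
    intro q hq
    -- If all cells of `q` contained `p`, then `q` would be a selector inside `p`, hence equal to
    -- `p` by minimality.
    obtain ⟨i, x, hx, hx'⟩ : ∃ i, ∃ x ∈ q.down.1 i, x ∉ p.down.1 i := by
      by_contra! hle
      exact hq (ULift.ext _ _ (Subtype.ext (le_antisymm hle (p.down.2.2 q.down.2.1 hle))))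
    refine ⟨i, x, hx, ?_⟩
    rintro r hr rfl
    exact hx' hr
  · rintro X _ ⟨i, h, rfl⟩ x
    have : (consolidate h (proj.{w} τ i)).cell x = ⋃ y ∈ {y | h.rel x y}, (τ.proj i).cell y := by
      ext p; simp [cell, consolidate_rel]
    rw [this]
    exact isOpen_biUnion fun y _ => hopen i y
  · intro 𝒰 h𝒰 hcov
    obtain ⟨i, hi⟩ := exists_level_refining h𝒰 hcov
    exact ⟨_, _, P.proj_mem i, hi⟩
  · intro n R
    rw [← isOpen_compl_iff]
    have : {a : Fin n → P.model.carrier | P.model.str.RelMap R a}ᶜ =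
        ⋃ c : {c : Σ i, Fin n → τ.X i // ¬ P.P (CoVal.id _) (.rel R c.2)},
          Set.univ.pi fun k => (proj.{w} τ c.1.1).cell (c.1.2 k) := by
      ext a
      rw [Set.mem_compl_iff, Set.mem_ofPred_eq, P.relMap_iff]
      simp only [Set.mem_iUnion, Set.mem_pi, Set.mem_univ, true_imp_iff]
      push Not
      constructor
      · rintro ⟨i, x, hx, hP⟩
        exact ⟨⟨⟨i, x⟩, hP⟩, hx⟩
      · rintro ⟨⟨⟨i, x⟩, hP⟩, hx⟩
        exact ⟨i, x, hx, hP⟩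
    rw [this]
    exact isOpen_iUnion fun c => isOpen_set_pi Set.finite_univ fun k _ => hopen _ _

end Valuation

end Tower

end CovLogic

/-! ### Forcing with formulas: generic sequences of conditions. -/

namespace CovLogic

open CoVal

universe t

set_option linter.checkUnivs false in
/-- A filtered family of structures with distinguished admissible co-valuations in the context
`B`. -/
structure Family (L : FirstOrder.Language.{u, v}) (B : Context) where
  ι : Type t
  N : ι → ProtoStructure.{u, v, w} L
  isStructure : ∀ s, (N s).IsStructure
  v : ∀ s, CoVal B (N s).carrier
  mem : ∀ s, v s ∈ (N s).V B
  l : Filter ι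
  neBot : l.NeBot

/-- A requirement on the co-valuations in the context `Y`: to have a fragmentation of one of
several patterns that satisfies the formula assigned to this pattern. -/
structure Requirement (L : FirstOrder.Language.{u, v}) where
  Y : Context
  S : Set (Σ Z : Context, CoVal Y Z × Formula L Z)

variable {L : FirstOrder.Language.{u, v}} {B : Context}

/-- The requirement is met by `q`. -/
def Requirement.Holds (ρ : Requirement L) (M : ProtoStructure.{u, v, w} L)
    (q : CoVal ρ.Y M.carrier) : Prop :=
  ∃ σ ∈ ρ.S, ∃ r ∈ M.V σ.1, consolidate σ.2.1 r = q ∧ M.Sat σ.2.2 r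

/-- The requirement that a co-valuation has a fragmentation of pattern `g` satisfying `φ`, unless
no co-valuation with this property exists. -/
abbrev Requirement.henkin {Y Z : Context} (g : CoVal Y Z) (φ : Formula L Z) :
    Requirement L where
  Y := Y
  S := {⟨Z, g, φ⟩, ⟨Y, CoVal.id Y, .neg (.ex g φ)⟩}

namespace Family

/-- A forcing condition: a formula about a fragmentation of the distinguished co-valuation. -/
structure Cond (L : FirstOrder.Language.{u, v}) (B : Context) where
  X : Context
  base : CoVal B X
  φ : Formula L X

variable (F : Family.{u, v, w, t} L B)

/-- `r` realizes the condition `c` in the structure with index `s`. -/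
def Realizes (c : Cond L B) (s : F.ι) (r : CoVal c.X (F.N s).carrier) : Prop :=
  r ∈ (F.N s).V c.X ∧ consolidate c.base r = F.v s ∧ (F.N s).Sat c.φ r

/-- A condition is consistent if it is frequently realized. -/
def Good (c : Cond L B) : Prop := ∃ᶠ s in F.l, ∃ r, F.Realizes c s r

/-- `c'` extends `c` along the pattern `g`. -/
def Extends (c c' : Cond L B) (g : CoVal c.X c'.X) : Prop :=
  consolidate c.base g = c'.base ∧ ∀ s r, F.Realizes c' s r → F.Realizes c s (consolidate g r)

/-- A requirement is dense if every consistent condition is consistent with one of its options. -/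
def Dense (ρ : Requirement L) : Prop :=
  ∀ c : Cond L B, F.Good c → ∀ h : CoVal ρ.Y c.X, ∃ σ ∈ ρ.S, ∃ᶠ s in F.l, ∃ r, F.Realizes c s r ∧
    ∃ q ∈ (F.N s).V σ.1, consolidate σ.2.1 q = consolidate h r ∧ (F.N s).Sat σ.2.2 q

/-- `c` forces that the requirement is met at the consolidation with pattern `h`. -/
def Met (ρ : Requirement L) (c : Cond L B) (h : CoVal ρ.Y c.X) : Prop :=
  ∃ σ ∈ ρ.S, ∃ h' : CoVal σ.1 c.X, consolidate σ.2.1 h' = h ∧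
    ∀ s r, F.Realizes c s r → (F.N s).Sat σ.2.2 (consolidate h' r)

variable {F}

theorem Extends.trans {c c' c'' : Cond L B} {g : CoVal c.X c'.X} {g' : CoVal c'.X c''.X}
    (h : F.Extends c c' g) (h' : F.Extends c' c'' g') : F.Extends c c'' (consolidate g g') :=
  ⟨by rw [← consolidate_assoc, h.1, h'.1], fun s r hr => by
    rw [consolidate_assoc]; exact h.2 s _ (h'.2 s r hr)⟩

theorem extends_id (c : Cond L B) : F.Extends c c (CoVal.id _) :=
  ⟨consolidate_id _, fun s r hr => by rwa [id_consolidate]⟩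

theorem Met.mono {ρ : Requirement L} {c c' : Cond L B} {g : CoVal c.X c'.X} {h : CoVal ρ.Y c.X}
    (hm : F.Met ρ c h) (hg : F.Extends c c' g) : F.Met ρ c' (consolidate h g) := by
  obtain ⟨σ, hσ, h', h1, h2⟩ := hm
  refine ⟨σ, hσ, consolidate h' g, by rw [← consolidate_assoc, h1], fun s r hr => ?_⟩
  rw [consolidate_assoc]
  exact h2 s _ (hg.2 s r hr)

/-- A realization of `c` and the co-valuation demanded by the option have a common fragmentation of
bounded size, so a single pair of patterns occurs frequently. The new condition is the conjunction
of both formulas, substituted along this pair. -/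
theorem Dense.exists_met {ρ : Requirement L} (hρ : F.Dense ρ) {c : Cond L B} (hc : F.Good c)
    (h : CoVal ρ.Y c.X) : ∃ c' : Cond L B, ∃ g : CoVal c.X c'.X, F.Good c' ∧ F.Extends c c' g ∧
      F.Met ρ c' (consolidate h g) := by
  obtain ⟨⟨Z, g', ψ⟩, hσ, hf⟩ := hρ c hc h
  have h1 : ∃ᶠ s in F.l, ∃ d : Σ k : Fin (Nat.card (Set c.X × Set Z) + 1),
      CoVal c.X (Finset.range k) × CoVal Z (Finset.range k), ∃ r ∈ (F.N s).V (Finset.range d.1),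
        F.Realizes c s (consolidate d.2.1 r) ∧ consolidate g' d.2.2 = consolidate h d.2.1 ∧
          (F.N s).Sat ψ (consolidate d.2.2 r) := by
    refine hf.mono ?_
    rintro s ⟨p, hp, q, hq, hqp, hs⟩
    obtain ⟨k, α, β, r, hr, rfl, rfl⟩ := (F.isStructure s).exists_common hp.1 hq
    rw [← consolidate_assoc, ← consolidate_assoc] at hqp
    exact ⟨⟨k, α, β⟩, r, hr, hp, consolidate_left_cancel hqp, hs⟩
  rw [Filter.frequently_exists] at h1
  obtain ⟨⟨k, α, β⟩, hf⟩ := h1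
  dsimp only at hf
  obtain ⟨φ', hφ'⟩ := Formula.exists_subst.{u, v, w} c.φ α
  obtain ⟨ψ', hψ'⟩ := Formula.exists_subst.{u, v, w} ψ β
  refine ⟨⟨_, consolidate c.base α, .and φ' ψ'⟩, α, hf.mono ?_, ⟨rfl, ?_⟩,
    ⟨Z, g', ψ⟩, hσ, β, ?_, ?_⟩
  · rintro s ⟨r, hr, h1, -, h3⟩
    exact ⟨r, hr, by rw [consolidate_assoc]; exact h1.2.1,
      (hφ' _ (F.isStructure s) r hr).2 h1.2.2, (hψ' _ (F.isStructure s) r hr).2 h3⟩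
  · rintro s r ⟨hr, h1, h2⟩
    exact ⟨(F.N s).closed _ _ hr, by rw [← consolidate_assoc]; exact h1,
      (hφ' _ (F.isStructure s) r hr).1 h2.1⟩
  · obtain ⟨s, r, -, -, h2, -⟩ := hf.exists
    exact h2
  · rintro s r ⟨hr, h1, h2⟩
    exact (hψ' _ (F.isStructure s) r hr).1 h2.2

theorem Dense.exists_forall_met {ρ : Requirement L} (hρ : F.Dense ρ) {c : Cond L B}
    (hc : F.Good c) : ∃ c' : Cond L B, ∃ g : CoVal c.X c'.X, F.Good c' ∧ F.Extends c c' g ∧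
      ∀ h : CoVal ρ.Y c.X, F.Met ρ c' (consolidate h g) := by
  have : ∀ s : Set (CoVal ρ.Y c.X), s.Finite → ∃ c' : Cond L B, ∃ g : CoVal c.X c'.X, F.Good c' ∧
      F.Extends c c' g ∧ ∀ h ∈ s, F.Met ρ c' (consolidate h g) := by
    intro s hs
    induction s, hs using Set.Finite.induction_on with
    | empty => exact ⟨c, CoVal.id _, hc, extends_id c, fun h hh => hh.elim⟩
    | @insert h s _ _ ih =>
      obtain ⟨c', g, hc', hg, hm⟩ := ih
      obtain ⟨c'', g', hc'', hg', hm'⟩ := hρ.exists_met hc' (consolidate h g)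
      refine ⟨c'', consolidate g g', hc'', hg.trans hg', ?_⟩
      rintro h' (rfl | hh)
      · rwa [← consolidate_assoc]
      · rw [← consolidate_assoc]; exact (hm h' hh).mono hg'
  obtain ⟨c', g, h1, h2, h3⟩ := this Set.univ Set.finite_univ
  exact ⟨c', g, h1, h2, fun h => h3 h trivial⟩

theorem Good.nonempty {c : Cond L B} (hc : F.Good c) : Nonempty c.X := by
  have := F.neBot
  obtain ⟨s, r, -⟩ := hc.exists
  exact r.rel_nonempty

/-- A generic sequence of conditions. -/
theorem exists_generic_seq {ρ : ℕ → Requirement L} (hρ : ∀ n, F.Dense (ρ n)) {c₀ : Cond L B}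
    (hc₀ : F.Good c₀) : ∃ (τ : Tower) (base : ∀ i, CoVal B (τ.X i)) (φ : ∀ i, Formula L (τ.X i)),
      (∀ i, F.Good ⟨_, base i, φ i⟩) ∧
      (∀ i j (hij : i ≤ j), F.Extends ⟨_, base i, φ i⟩ ⟨_, base j, φ j⟩ (τ.g hij)) ∧
      ∀ n i (h : CoVal (ρ n).Y (τ.X i)), ∃ j, ∃ hij : i ≤ j,
        F.Met (ρ n) ⟨_, base j, φ j⟩ (consolidate h (τ.g hij)) := by
  choose C G hC hG hM using fun (n : ℕ) (c : {c : Cond L B // F.Good c}) =>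
    (hρ n).exists_forall_met c.2
  -- Stage `n` serves requirement `n.unpair.1`, so each requirement recurs infinitely often, for all
  -- patterns of the current context at once.
  let seq : ℕ → {c : Cond L B // F.Good c} := fun n =>
    Nat.rec ⟨c₀, hc₀⟩ (fun n c => ⟨C n.unpair.1 c, hC n.unpair.1 c⟩) n
  let τ : Tower := .ofSucc (fun i => (seq i).1.X) (fun i => G i.unpair.1 (seq i))
    fun i => (seq i).2.nonempty
  have hE : ∀ i j (hij : i ≤ j), F.Extends (seq i).1 (seq j).1 (τ.g hij) := by
    intro i j hij
    induction j, hij using Nat.le_induction with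
    | base => rw [τ.g_self]; exact extends_id _
    | succ j hij ih =>
      have := Tower.ofSucc_g_step (fun i => (seq i).1.X) (fun i => G i.unpair.1 (seq i))
        (fun i => (seq i).2.nonempty) hij
      rw [show τ.g (hij.trans (Nat.le_succ j)) = _ from this]
      exact ih.trans (hG j.unpair.1 (seq j))
  refine ⟨τ, fun i => (seq i).1.base, fun i => (seq i).1.φ, fun i => (seq i).2, hE, ?_⟩
  intro n i h
  obtain ⟨m, rfl, him⟩ : ∃ m : ℕ, m.unpair.1 = n ∧ i ≤ m :=
    ⟨Nat.pair n i, by simp, Nat.right_le_pair n i⟩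
  refine ⟨m + 1, him.trans (Nat.le_succ _), ?_⟩
  have h1 := Tower.ofSucc_g_step (fun i => (seq i).1.X) (fun i => G i.unpair.1 (seq i))
    (fun i => (seq i).2.nonempty) him
  rw [show τ.g (him.trans (Nat.le_succ _)) = _ from h1, ← consolidate_assoc]
  exact hM m.unpair.1 (seq m) _

/-- Every realization satisfies one of the two options, so one of them occurs frequently. -/
theorem dense_henkin {Y Z : Context} (g : CoVal Y Z) (φ : Formula L Z) :
    F.Dense (.henkin g φ) := by
  intro c hc h
  have h1 : ∃ᶠ s in F.l, (∃ r, F.Realizes c s r ∧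
      ∃ q ∈ (F.N s).V Z, consolidate g q = consolidate h r ∧ (F.N s).Sat φ q) ∨
      ∃ r, F.Realizes c s r ∧ ∃ q ∈ (F.N s).V Y, consolidate (CoVal.id Y) q = consolidate h r ∧
        (F.N s).Sat (.neg (.ex g φ)) q := by
    refine hc.mono ?_
    rintro s ⟨r, hr⟩
    by_cases hs : (F.N s).Sat (.ex g φ) (consolidate h r)
    · obtain ⟨q, hq, h1, h2⟩ := hs
      exact .inl ⟨r, hr, q, hq, h1.symm, h2⟩
    · exact .inr ⟨r, hr, _, (F.N s).closed h r hr.1, id_consolidate _, hs⟩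
  rcases Filter.frequently_or_distrib.1 h1 with h1 | h1
  · exact ⟨_, .inl rfl, h1⟩
  · exact ⟨_, .inr rfl, h1⟩


variable (F) in
/-- A sequence of conditions that is generic enough to determine a structure. -/
structure Generic where
  τ : Tower
  base : ∀ i, CoVal B (τ.X i)
  φ : ∀ i, Formula L (τ.X i)
  good : ∀ i, F.Good ⟨_, base i, φ i⟩
  ext : ∀ i j (hij : i ≤ j), F.Extends ⟨_, base i, φ i⟩ ⟨_, base j, φ j⟩ (τ.g hij)
  henkin : ∀ {Y Z : Context} (g : CoVal Y Z) (ψ : Formula L Z) i (h : CoVal Y (τ.X i)), ∃ j,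
    ∃ hij : i ≤ j, F.Met (.henkin g ψ) ⟨_, base j, φ j⟩ (consolidate h (τ.g hij))

theorem exists_generic [Countable (Σ n, L.Relations n)] {E : Set (Requirement L)}
    (hE : E.Countable) (hD : ∀ ρ ∈ E, F.Dense ρ) : ∃ G : F.Generic, ∀ ρ ∈ E, ∀ i
      (h : CoVal ρ.Y (G.τ.X i)), ∃ j, ∃ hij : i ≤ j,
        F.Met ρ ⟨_, G.base j, G.φ j⟩ (consolidate h (G.τ.g hij)) := by
  have := hE.to_subtype
  let R : (Σ Y Z : Context, CoVal Y Z × Formula L Z) ⊕ E → Requirement L :=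
    Sum.elim (fun t => .henkin t.2.2.1 t.2.2.2) fun ρ => ρ
  have : Nonempty ((Σ Y Z : Context, CoVal Y Z × Formula L Z) ⊕ E) :=
    ⟨.inl ⟨B, B, CoVal.id _, .bot⟩⟩
  obtain ⟨e, he⟩ := exists_surjective_nat ((Σ Y Z : Context, CoVal Y Z × Formula L Z) ⊕ E)
  have hR : ∀ t, F.Dense (R t) := by
    rintro (⟨Y, Z, g, ψ⟩ | ⟨ρ, hρ⟩)
    · exact dense_henkin g ψ
    · exact hD ρ hρ
  have h₀ : F.Good ⟨B, CoVal.id _, .neg .bot⟩ := by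
    have := F.neBot
    exact (Filter.Eventually.of_forall fun s =>
      ⟨F.v s, F.mem s, id_consolidate _, fun h => h⟩).frequently
  obtain ⟨τ, base, φ, h1, h2, h3⟩ := exists_generic_seq (fun n => hR (e n)) h₀
  refine ⟨⟨τ, base, φ, h1, h2, fun {Y Z} g ψ i h => ?_⟩, fun ρ hρ i h => ?_⟩
  · obtain ⟨n, hn⟩ := he (.inl ⟨Y, Z, g, ψ⟩)
    have := h3 n
    rw [hn] at this
    exact this i h
  · obtain ⟨n, hn⟩ := he (.inr ⟨ρ, hρ⟩)
    have := h3 n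
    rw [hn] at this
    exact this i h

namespace Generic

open Filter

variable (G : F.Generic)

/-- The conditions of a generic sequence. -/
abbrev cond (i : ℕ) : Cond L B := ⟨_, G.base i, G.φ i⟩

/-- The formulas forced at the consolidation with pattern `h` of a level of a generic sequence. -/
def Forced {i : ℕ} {Y : Context} (h : CoVal Y (G.τ.X i)) (ψ : Formula L Y) : Prop :=
  ∀ᶠ k in atTop, ∀ hik : i ≤ k, ∀ s r, F.Realizes (G.cond k) s r →
    (F.N s).Sat ψ (consolidate h (consolidate (G.τ.g hik) r))

variable {G} {i : ℕ} {Y : Context} {h : CoVal Y (G.τ.X i)}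

theorem forced_of {j : ℕ} (hij : i ≤ j) {ψ : Formula L Y}
    (hj : ∀ s r, F.Realizes (G.cond j) s r →
      (F.N s).Sat ψ (consolidate (consolidate h (G.τ.g hij)) r)) : G.Forced h ψ := by
  filter_upwards [eventually_ge_atTop j] with k hjk hik s r hr
  have := hj s _ ((G.ext j k hjk).2 s r hr)
  rwa [consolidate_assoc, ← consolidate_assoc (G.τ.g hij), G.τ.g_comp] at this

/-- Finitely many properties that hold eventually hold simultaneously in some realization. -/
theorem exists_realizes {p : ℕ → Prop} (hp : ∀ᶠ k in atTop, p k) (i : ℕ) :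
    ∃ k, ∃ _ : i ≤ k, p k ∧ ∃ s r, F.Realizes (G.cond k) s r := by
  obtain ⟨k, hk, hik⟩ := (hp.and (eventually_ge_atTop i)).exists
  have := F.neBot
  exact ⟨k, hik, hk, (G.good k).exists⟩

theorem not_forced_bot : ¬ G.Forced h .bot := by
  intro hf
  obtain ⟨k, hik, hk, s, r, hr⟩ := exists_realizes (G := G) hf i
  exact hk hik s r hr

theorem forced_neg {ψ : Formula L Y} : G.Forced h (.neg ψ) ↔ ¬ G.Forced h ψ := by
  constructor
  · intro h1 h2
    obtain ⟨k, hik, ⟨h1, h2⟩, s, r, hr⟩ := exists_realizes (G := G) (h1.and h2) i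
    exact h1 hik s r hr (h2 hik s r hr)
  · intro hf
    -- With the identity pattern, the Henkin requirement decides `ψ` itself.
    obtain ⟨j, hij, _, (rfl | rfl), h', h1, h2⟩ := G.henkin (CoVal.id Y) ψ i h
    · rw [id_consolidate] at h1
      subst h1
      exact (hf (forced_of hij h2)).elim
    · rw [id_consolidate] at h1
      subst h1
      refine forced_of hij fun s r hr hs => h2 s r hr ⟨_, (F.N s).closed _ _ hr.1, ?_, hs⟩
      rw [id_consolidate]

theorem forced_and {ψ θ : Formula L Y} : G.Forced h (.and ψ θ) ↔ G.Forced h ψ ∧ G.Forced h θ := by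
  constructor
  · intro hf
    exact ⟨hf.mono fun k hk hik s r hr => (hk hik s r hr).1,
      hf.mono fun k hk hik s r hr => (hk hik s r hr).2⟩
  · rintro ⟨h1, h2⟩
    filter_upwards [h1, h2] with k h1 h2 hik s r hr
    exact ⟨h1 hik s r hr, h2 hik s r hr⟩

theorem forced_mono {j : ℕ} (hij : i ≤ j) {ψ : Formula L Y} :
    G.Forced h ψ ↔ G.Forced (consolidate h (G.τ.g hij)) ψ := by
  constructor
  · intro hf
    filter_upwards [hf] with k hk hjk s r hr
    have := hk (hij.trans hjk) s r hr
    rwa [← G.τ.g_comp hij hjk, consolidate_assoc, ← consolidate_assoc] at this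
  · intro hf
    filter_upwards [hf, eventually_ge_atTop j] with k hk hjk hik s r hr
    have := hk hjk s r hr
    rwa [consolidate_assoc, ← consolidate_assoc (G.τ.g hij), G.τ.g_comp hij hjk] at this

/-- If no disjunct were forced, all the finitely many negations would hold at realizations of one
late stage, which are not lacking. -/
theorem exists_forced {κ : Type*} [Finite κ] (f : κ → Formula L Y)
    (hf : ∀ᶠ k in atTop, ∀ hik : i ≤ k, ∀ s r, F.Realizes (G.cond k) s r →
      ∃ a, (F.N s).Sat (f a) (consolidate h (consolidate (G.τ.g hik) r))) :
    ∃ a, G.Forced h (f a) := by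
  by_contra! hne
  have h1 : ∀ᶠ k in atTop, ∀ a, _ := eventually_all.2 fun a => forced_neg.2 (hne a)
  obtain ⟨k, hik, ⟨h1, h2⟩, s, r, hr⟩ := exists_realizes (G := G) (h1.and hf) i
  obtain ⟨a, ha⟩ := h2 hik s r hr
  exact h1 a hik s r hr ha

theorem forced_ex {Z : Context} (g : CoVal Y Z) {ψ : Formula L Z} :
    G.Forced h (.ex g ψ) ↔ ∃ j, ∃ hij : i ≤ j, ∃ h' : CoVal Z (G.τ.X j),
      consolidate g h' = consolidate h (G.τ.g hij) ∧ G.Forced h' ψ := by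
  constructor
  · intro hf
    obtain ⟨j, hij, _, (rfl | rfl), h', h1, h2⟩ := G.henkin g ψ i h
    · refine ⟨j, hij, h', h1, forced_of le_rfl fun s r hr => ?_⟩
      rw [G.τ.g_self, consolidate_id]
      exact h2 s r hr
    · rw [id_consolidate] at h1
      subst h1
      exact (forced_neg.1 (forced_of hij h2) hf).elim
  · rintro ⟨j, hij, h', h1, hf⟩
    filter_upwards [hf, eventually_ge_atTop j] with k hk hjk hik s r hr
    refine ⟨consolidate h' (consolidate (G.τ.g hjk) r),
      (F.N s).closed _ _ ((F.N s).closed _ _ hr.1), ?_, hk hjk s r hr⟩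
    rw [← consolidate_assoc g, h1, consolidate_assoc, ← consolidate_assoc (G.τ.g hij),
      G.τ.g_comp hij hjk]

theorem forced_rel {n : ℕ} {R : L.Relations n} {x : Fin n → Y} : G.Forced h (.rel R x) ↔
    ∃ z, (∀ k, h.rel (x k) (z k)) ∧ G.Forced (CoVal.id (G.τ.X i)) (.rel R z) := by
  constructor
  · intro hf
    obtain ⟨⟨z, hz⟩, hz'⟩ := exists_forced (h := CoVal.id (G.τ.X i))
      (fun z : {z : Fin n → G.τ.X i // ∀ k, h.rel (x k) (z k)} => Formula.rel R z.1) (by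
        filter_upwards [hf] with k hk hik s r hr
        obtain ⟨a, ha, hR⟩ := hk hik s r hr
        choose z hz hz' using ha
        exact ⟨⟨z, hz⟩, ProtoStructure.sat_rel.2 ⟨a, by rwa [id_consolidate], hR⟩⟩)
    exact ⟨z, hz, hz'⟩
  · rintro ⟨z, hz, hf⟩
    filter_upwards [hf] with k hk hik s r hr
    obtain ⟨a, ha, hR⟩ := hk hik s r hr
    rw [id_consolidate] at ha
    exact ⟨a, fun k => ⟨z k, hz k, ha k⟩, hR⟩

/-- The witness axiom gives co-valuations that vary with the structure, but by the size bounds only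
finitely many patterns `(k, m, α, β, y)` arise, so one of them is forced. Since the formulas of
`exists_core` persist in all fragmentations, `R` is then forced inside the cores at every later
level. -/
theorem exists_forced_witness {n : ℕ} {R : L.Relations n} {x : Fin n → G.τ.X i}
    (hf : G.Forced (CoVal.id (G.τ.X i)) (.rel R x)) :
    ∃ j, ∃ hij : i ≤ j, ∃ Y : Context, ∃ q : CoVal Y (G.τ.X j),
      ∃ y : Fin n → Y, (∀ k z, q.rel (y k) z → (G.τ.g hij).rel (x k) z) ∧
        ∀ l (hjl : j ≤ l), ∃ z, (∀ k, z k ∈ (consolidate q (G.τ.g hjl)).core (y k)) ∧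
          G.Forced (CoVal.id (G.τ.X l)) (.rel R z) := by
  choose χ hχ using fun (Y : Context) (y : Fin n → Y) => Formula.exists_core.{u, v, w} R y
  choose σ hσ using fun (Y Z : Context) (β : CoVal Y Z) (φ : Formula L Y) =>
    Formula.exists_subst.{u, v, w} φ β
  obtain ⟨⟨⟨k, m, α, β, y⟩, hc⟩, hex⟩ := exists_forced (h := CoVal.id (G.τ.X i))
    (fun c : {c : Σ k : Fin (Nat.card (Set (Fin n)) + 1),
        Σ m : Fin (Nat.card (Set (G.τ.X i) × Set (Finset.range k)) + 1),
          CoVal (G.τ.X i) (Finset.range m) × CoVal (Finset.range k) (Finset.range m) ×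
            (Fin n → Finset.range k) //
              ∀ k z, c.2.2.2.1.rel (c.2.2.2.2 k) z → c.2.2.1.rel (x k) z} =>
      Formula.ex c.1.2.2.1 (σ _ _ c.1.2.2.2.1 (χ _ c.1.2.2.2.2))) (by
    filter_upwards [hf] with k hk hik s r hr
    have hs := hk hik s r hr
    rw [id_consolidate] at hs ⊢
    have hr' := (F.N s).closed (G.τ.g hik) r hr.1
    obtain ⟨k, q, hq, y, a, h1, h2, h3⟩ := (F.isStructure s).exists_witness hr' hs
    obtain ⟨m, α, β, p, hp, hαp, rfl⟩ := (F.isStructure s).exists_common hr' hq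
    rw [← hαp] at h2 ⊢
    refine ⟨⟨⟨k, m, α, β, y⟩, fun k z hz => ?_⟩, ProtoStructure.sat_ex.2 ⟨p, hp, rfl, ?_⟩⟩
    · rw [rel_iff_cell_subset α p]
      exact ((rel_iff_cell_subset β p _ _).1 hz).trans (h2 k)
    · exact (hσ _ _ β _ _ (F.isStructure s) p hp).2 ((hχ _ y _).1 _ hq ⟨a, h1, h3⟩))
  obtain ⟨j, hij, h', hα, hf'⟩ := (forced_ex _).1 hex
  rw [id_consolidate] at hα
  refine ⟨j, hij, _, consolidate β h', y, ?_, fun l hjl => ?_⟩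
  · rintro k z ⟨t, ht, htz⟩
    rw [← hα]
    exact ⟨t, hc k t ht, htz⟩
  · obtain ⟨⟨z, hz⟩, hzR⟩ := exists_forced (h := CoVal.id (G.τ.X l))
      (fun z : {z : Fin n → G.τ.X l // ∀ k, z k ∈ (consolidate (consolidate β h')
        (G.τ.g hjl)).core (y k)} => Formula.rel R z.1) (by
      filter_upwards [(forced_mono hjl).1 hf'] with k hk hlk s r hr
      have hs := hk hlk s r hr
      have hr' := (F.N s).closed (G.τ.g hlk) r hr.1
      have h1 := (hσ _ _ β _ _ (F.isStructure s) _ ((F.N s).closed _ _ hr')).1 hs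
      rw [← consolidate_assoc, ← consolidate_assoc β] at h1
      obtain ⟨z, hz, hzR⟩ := (hχ _ y (F.N s)).2 _ _ _ hr' h1
      exact ⟨⟨z, hz⟩, by rwa [id_consolidate]⟩)
    exact ⟨z, hz, hzR⟩

variable (G) in
/-- The valuation of formulas determined by a generic sequence. -/
def valuation : G.τ.Valuation L where
  P h ψ := G.Forced h ψ
  bot _ := not_forced_bot
  neg _ _ := forced_neg
  and _ _ _ := forced_and
  ex _ g _ := forced_ex g
  rel _ _ _ _ := forced_rel
  mono hij _ _ _ := forced_mono hij
  witness _ _ hf := exists_forced_witness hf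

end Generic

/-- The limit of a generic sequence. -/
theorem exists_compact_omega [L.IsRelational] [Countable (Σ n, L.Relations n)]
    (F : Family.{u, v, w, t} L B) {E : Set (Requirement L)} (hE : E.Countable)
    (hD : ∀ ρ ∈ E, F.Dense ρ) : ∃ M : ProtoStructure.{u, v, w} L, M.IsStructure ∧ M.IsCompact ∧
      M.IsOmega ∧ (∃ q ∈ M.V B, ∀ φ, (∀ᶠ s in F.l, (F.N s).Sat φ (F.v s)) → M.Sat φ q) ∧
        ∀ ρ ∈ E, ∀ q ∈ M.V ρ.Y, ρ.Holds M q := by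
  obtain ⟨G, hG⟩ := F.exists_generic hE hD
  refine ⟨G.valuation.model, G.valuation.isStructure_model, G.valuation.isCompact_model,
    G.valuation.isOmega_model, ⟨_, ⟨0, G.base 0, rfl⟩, fun φ hφ => ?_⟩, ?_⟩
  · rw [G.valuation.sat_iff]
    by_contra hne
    -- The negation of `φ` would hold at all realizations of one condition; these occur frequently,
    -- whereas `φ` holds eventually.
    obtain ⟨k, hk, h0⟩ := ((Generic.forced_neg.2 hne).and (Filter.eventually_ge_atTop 0)).exists
    obtain ⟨s, ⟨r, hr⟩, hs⟩ := ((G.good k).and_eventually hφ).exists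
    refine hk h0 s r hr ?_
    rw [← consolidate_assoc, (G.ext 0 k h0).1, hr.2.1]
    exact hs
  · rintro ρ hρ _ ⟨i, h, rfl⟩
    obtain ⟨j, hij, σ, hσ, h', h1, h2⟩ := hG ρ hρ i h
    refine ⟨σ, hσ, _, ⟨j, h', rfl⟩, ?_, ?_⟩
    · rw [← Tower.consolidate_proj hij, ← consolidate_assoc, ← consolidate_assoc, h1]
    · rw [G.valuation.sat_iff]
      refine Generic.forced_of le_rfl fun s r hr => ?_
      rw [G.τ.g_self, consolidate_id]
      exact h2 s r hr

end Family

end CovLogic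

/-! ### Presentations of compact structures, and back and forth. -/

namespace CovLogic

open CoVal

variable {L : FirstOrder.Language.{u, v}}

namespace ProtoStructure

variable {M N : ProtoStructure.{u, v, w} L} {τ : Tower}

/-- A cofinal sequence of admissible co-valuations, with the tower of its patterns. -/
structure Presentation (M : ProtoStructure.{u, v, w} L) (τ : Tower) where
  p : ∀ i, CoVal (τ.X i) M.carrier
  mem : ∀ i, p i ∈ M.V (τ.X i)
  comp : ∀ {i j : ℕ} (hij : i ≤ j), consolidate (τ.g hij) (p j) = p i
  gen : ∀ {Y : Context} (q : CoVal Y M.carrier), q ∈ M.V Y → ∃ i, q.Consolidates (p i)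

namespace Presentation

variable (P : M.Presentation τ)

/-- The cells that contain the point `a`. -/
def trace (a : M.carrier) (i : ℕ) : Set (τ.X i) := {x | (P.p i).rel x a}

theorem mem_trace {a : M.carrier} {i : ℕ} {x : τ.X i} : x ∈ P.trace a i ↔ (P.p i).rel x a := Iff.rfl

theorem isSelector_trace (a : M.carrier) : τ.IsSelector (P.trace a) :=
  ⟨fun i j hij x y hxy hy => by
    rw [mem_trace, ← P.comp hij]; exact ⟨y, hxy, hy⟩, fun i => (P.p i).cosurj a⟩

variable {P}

/-- In a compact structure, every open cover is refined by a member of a presentation. -/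
theorem exists_refining {_ : TopologicalSpace M.carrier}
    (href : ∀ U : Set (Set M.carrier), (∀ s ∈ U, IsOpen s) → ⋃₀ U = Set.univ →
      ∃ X : Context, ∃ p ∈ M.V X, ∀ x, ∃ s ∈ U, p.cell x ⊆ s)
    {U : Set (Set M.carrier)} (hU : ∀ s ∈ U, IsOpen s) (hcov : ⋃₀ U = Set.univ) :
    ∃ i, ∀ x, ∃ s ∈ U, (P.p i).cell x ⊆ s := by
  obtain ⟨X, q, hq, hqU⟩ := href U hU hcov
  obtain ⟨i, g, rfl⟩ := P.gen q hq
  refine ⟨i, fun y => ?_⟩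
  obtain ⟨x, hx⟩ := g.cosurj y
  obtain ⟨s, hs, hxs⟩ := hqU x
  exact ⟨s, hs, ((rel_iff_cell_subset g _ x y).1 hx).trans hxs⟩

/-- In a compact structure, every open neighbourhood of a point contains all the cells of some
member of the presentation that contain this point. -/
theorem exists_cell_subset {t : TopologicalSpace M.carrier} [T1Space M.carrier]
    (href : ∀ U : Set (Set M.carrier), (∀ s ∈ U, IsOpen s) → ⋃₀ U = Set.univ →
      ∃ X : Context, ∃ p ∈ M.V X, ∀ x, ∃ s ∈ U, p.cell x ⊆ s)
    {U : Set M.carrier} (hU : IsOpen U) {a : M.carrier} (ha : a ∈ U) :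
    ∃ i, ∀ x ∈ P.trace a i, (P.p i).cell x ⊆ U := by
  obtain ⟨i, hi⟩ := exists_refining (P := P) href (U := {U, {a}ᶜ})
    (by rintro s (rfl | rfl); exacts [hU, isOpen_compl_singleton])
    (by
      refine Set.eq_univ_of_forall fun b => ?_
      by_cases hb : b = a
      · exact ⟨U, .inl rfl, hb ▸ ha⟩
      · exact ⟨{a}ᶜ, .inr rfl, hb⟩)
  refine ⟨i, fun x hx => ?_⟩
  obtain ⟨s, (rfl | rfl), hs⟩ := hi x
  · exact hs
  · exact (hs hx rfl).elim

variable (P)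

theorem eq_of_trace_le (hM : M.IsCompact) {a b : M.carrier} (h : P.trace a ≤ P.trace b) :
    a = b := by
  obtain ⟨t, -, hT1, hopen, href, -⟩ := hM
  by_contra hne
  obtain ⟨i, hi⟩ := exists_cell_subset (P := P) href (U := {b}ᶜ) isOpen_compl_singleton hne
  obtain ⟨x, hx⟩ := (P.isSelector_trace a).2 i
  exact hi x hx (h i hx) rfl

/-- Otherwise the cells with index outside `S` cover `M`. A level refines this cover, and at a later
level an index in `S` would lie below an index outside `S`. -/
theorem exists_trace_le (hM : M.IsCompact) {S : ∀ i, Set (τ.X i)} (hS : τ.IsSelector S) :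
    ∃ a, P.trace a ≤ S := by
  obtain ⟨t, -, hT1, hopen, href, -⟩ := hM
  by_contra! hne
  obtain ⟨j, hj⟩ := exists_refining (P := P) href
    (U := {s | ∃ i, ∃ x, x ∉ S i ∧ s = (P.p i).cell x})
    (by rintro _ ⟨i, x, -, rfl⟩; exact hopen _ _ (P.mem i) x)
    (by
      refine Set.eq_univ_of_forall fun a => ?_
      obtain ⟨i, hi⟩ := not_forall.1 (hne a)
      obtain ⟨x, hx, hx'⟩ := Set.not_subset.1 hi
      exact ⟨_, ⟨i, x, hx', rfl⟩, hx⟩)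
  choose s hs hsub using hj
  choose i x hx hsx using hs
  obtain ⟨k, hk⟩ := (Set.finite_range i).bddAbove
  have hk' : ∀ y, i y ≤ max j k := fun y => (hk ⟨y, rfl⟩).trans (le_max_right _ _)
  obtain ⟨z, hz⟩ := hS.2 (max j k)
  obtain ⟨y, hy⟩ := (τ.g (le_max_left j k)).cosurj z
  refine hx y (hS.1 _ _ (hk' y) _ z ?_ hz)
  rw [rel_iff_cell_subset _ (P.p (max j k))] at hy ⊢
  rw [P.comp] at hy ⊢
  rw [← hsx]
  exact hy.trans (hsub y)

theorem minimal_trace (hM : M.IsCompact) (a : M.carrier) : Minimal τ.IsSelector (P.trace a) := by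
  refine ⟨P.isSelector_trace a, fun S hS hle => ?_⟩
  obtain ⟨b, hb⟩ := P.exists_trace_le hM hS
  rwa [P.eq_of_trace_le hM (hb.trans hle)] at hb

/-- The points of a compact structure are the minimal selectors of the tower of any of its
presentations. -/
noncomputable def equivPoint (hM : M.IsCompact) : M.carrier ≃ τ.Point :=
  Equiv.ofBijective (fun a => ⟨P.trace a, P.minimal_trace hM a⟩) (by
    refine ⟨fun a b hab => P.eq_of_trace_le hM (Subtype.ext_iff.1 hab).le, fun S => ?_⟩
    obtain ⟨a, ha⟩ := P.exists_trace_le hM S.2.1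
    exact ⟨a, Subtype.ext (le_antisymm ha (S.2.2 (P.isSelector_trace a) ha))⟩)

theorem relMap_iff (hM : M.IsCompact) {n : ℕ} (R : L.Relations n) (a : Fin n → M.carrier) :
    FirstOrder.Language.Structure.RelMap R a ↔ ∀ i (x : Fin n → τ.X i),
      (∀ k, x k ∈ P.trace (a k) i) → M.Sat (.rel R x) (P.p i) := by
  refine ⟨fun hR i x hx => ⟨a, hx, hR⟩, fun h => ?_⟩
  obtain ⟨t, -, hT1, hopen, href, hclosed⟩ := hM
  by_contra hR
  -- A closed relation missing `a` misses an open box around it; at a late level the cells of the `a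
  -- k` fit inside that box, yet `R` meets their product.
  obtain ⟨U, hU, hsub⟩ := isOpen_pi_iff'.1 (hclosed n R).isOpen_compl a hR
  choose i hi using fun k => exists_cell_subset (P := P) href (hU k).1 (hU k).2
  obtain ⟨j, hj⟩ := (Set.finite_range i).bddAbove
  have hj' : ∀ k, i k ≤ j := fun k => hj ⟨k, rfl⟩
  choose x hx using fun k => (P.isSelector_trace (a k)).2 j
  obtain ⟨b, hb, hR'⟩ := h j x hx
  refine hsub (a := b) (fun k _ => ?_) hR'
  obtain ⟨y, hy⟩ := (τ.g (hj' k)).cosurj (x k)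
  refine hi k y ((P.isSelector_trace (a k)).1 _ _ (hj' k) y _ hy (hx k)) ?_
  rw [cell, Set.mem_ofPred_eq, ← P.comp (hj' k)]
  exact ⟨_, hy, hb k⟩

/-- Compact structures with presentations that have the same patterns and types are isomorphic. -/
theorem isomorphic [L.IsRelational] (hM : M.IsCompact) (hN : N.IsCompact) (Q : N.Presentation τ)
    (hPQ : ∀ i (φ : Formula L (τ.X i)), M.Sat φ (P.p i) ↔ N.Sat φ (Q.p i)) :
    M.Isomorphic N := by
  let e : M.carrier ≃ N.carrier := (P.equivPoint hM).trans (Q.equivPoint hN).symm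
  have he : ∀ a, Q.trace (e a) = P.trace a := fun a =>
    Subtype.ext_iff.1 ((Q.equivPoint hN).apply_symm_apply (P.equivPoint hM a))
  have hmap : ∀ i, (P.p i).map e = Q.p i := by
    intro i
    ext x b
    obtain ⟨a, rfl⟩ := e.surjective b
    change (P.p i).rel x (e.symm (e a)) ↔ x ∈ Q.trace (e a) i
    rw [he, e.symm_apply_apply]
    rfl
  have hcons : ∀ {X Y : Context} (h : CoVal X Y) (q : CoVal Y M.carrier),
    (consolidate h q).map e = consolidate h (q.map e) := fun h q => rfl
  refine ⟨⟨e, fun f => isEmptyElim f, fun R a => ?_⟩, fun X => ?_⟩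
  · rw [P.relMap_iff hM, Q.relMap_iff hN]
    refine forall_congr' fun i => forall_congr' fun x => ?_
    rw [hPQ i]
    refine imp_congr_left (forall_congr' fun k => ?_)
    exact he (a k) ▸ Iff.rfl
  · ext q
    constructor
    · rintro ⟨q, hq, rfl⟩
      obtain ⟨i, h, rfl⟩ := P.gen q hq
      change (consolidate h (P.p i)).map e ∈ _
      rw [hcons, hmap]
      exact N.closed _ _ (Q.mem i)
    · intro hq
      obtain ⟨i, h, rfl⟩ := Q.gen q hq
      refine ⟨consolidate h (P.p i), M.closed _ _ (P.mem i), ?_⟩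
      change (consolidate h (P.p i)).map e = _
      rw [hcons, hmap]

end Presentation

/-- Isomorphisms preserve satisfaction. -/
theorem sat_map {f : L.Equiv M.carrier N.carrier}
    (hf : ∀ X : Context, CoVal.map f.toEquiv '' M.V X = N.V X) {X : Context} (φ : Formula L X) :
    ∀ q : CoVal X M.carrier, N.Sat φ (q.map f.toEquiv) ↔ M.Sat φ q := by
  have hinj : ∀ {X : Context} {q r : CoVal X M.carrier}, q.map f.toEquiv = r.map f.toEquiv →
      q = r := by
    intro X q r h
    ext x a
    have := congrArg (fun s => s.rel x (f.toEquiv a)) h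
    simpa [CoVal.map] using this
  induction φ with
  | bot => exact fun q => Iff.rfl
  | rel R x =>
    intro q
    rw [sat_rel, sat_rel]
    constructor
    · rintro ⟨b, hb, hR⟩
      refine ⟨fun k => f.toEquiv.symm (b k), hb, (f.map_rel R _).1 ?_⟩
      convert hR using 1
      funext k
      exact f.toEquiv.apply_symm_apply (b k)
    · rintro ⟨a, ha, hR⟩
      refine ⟨fun k => f.toEquiv (a k), fun k => ?_, (f.map_rel R a).2 hR⟩
      change q.rel _ (f.toEquiv.symm (f.toEquiv (a k)))
      rw [f.toEquiv.symm_apply_apply]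
      exact ha k
  | neg φ ih => exact fun q => not_congr (ih q)
  | and φ ψ ih1 ih2 => exact fun q => and_congr (ih1 q) (ih2 q)
  | ex g φ ih =>
    intro q
    rw [sat_ex, sat_ex]
    constructor
    · rintro ⟨r, hr, hqr, hs⟩
      rw [← hf] at hr
      obtain ⟨r, hr, rfl⟩ := hr
      exact ⟨r, hr, hinj hqr, (ih r).1 hs⟩
    · rintro ⟨r, hr, rfl, hs⟩
      exact ⟨r.map f.toEquiv, hf _ ▸ ⟨r, hr, rfl⟩, rfl, (ih r).2 hs⟩

theorem Isomorphic.realizes_iff (h : M.Isomorphic N) {X : Context} {p : Set (Formula L X)} :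
    M.Realizes p ↔ N.Realizes p := by
  obtain ⟨f, hf⟩ := h
  constructor
  · rintro ⟨q, hq, hs⟩
    exact ⟨q.map f.toEquiv, hf X ▸ ⟨q, hq, rfl⟩, fun φ hφ => (sat_map hf φ q).2 (hs φ hφ)⟩
  · rintro ⟨q, hq, hs⟩
    rw [← hf] at hq
    obtain ⟨q, hq, rfl⟩ := hq
    exact ⟨q, hq, fun φ hφ => (sat_map hf φ q).1 (hs φ hφ)⟩

theorem IsStructure.total_mem (hM : M.IsStructure) : M.total ∈ M.V star := by
  obtain ⟨X, q, hq⟩ := hM.nonempty_V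
  have := q.rel_nonempty
  rw [Subsingleton.elim M.total (consolidate (CoVal.const star X) q)]
  exact M.closed _ _ hq

variable {T : Theory L}

/-- If every type is isolated, then fragmentations can be transferred along equality of types. -/
theorem exists_fragmentation (hT : Theory.EveryTypeIsolated.{u, v, w} T) (hM : M.IsModel T)
    (hN : N.IsModel T) {X Z : Context} {g : CoVal X Z} {p : CoVal Z M.carrier} (hp : p ∈ M.V Z)
    {q : CoVal X N.carrier}
    (hpq : ∀ φ : Formula L X, M.Sat φ (consolidate g p) ↔ N.Sat φ q) :
    ∃ r ∈ N.V Z, q = consolidate g r ∧ ∀ φ : Formula L Z, M.Sat φ p ↔ N.Sat φ r := by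
  obtain ⟨φ, ⟨K, hK, k, hk, hφk⟩, hφ⟩ := hT Z {φ | M.Sat φ p} ⟨M, hM, p, hp, fun _ h => h⟩
  -- The isolating formula belongs to the type: otherwise it would imply its own negation where it
  -- is realized.
  have hφp : M.Sat φ p := by
    by_contra hne
    exact hφ K hK k hk (hφk φ rfl) (.neg φ) hne (hφk φ rfl)
  obtain ⟨r, hr, hqr, hφr⟩ := sat_ex.1 ((hpq (.ex g φ)).1 ⟨p, hp, rfl, hφp⟩)
  refine ⟨r, hr, hqr, fun ψ => ⟨hφ N hN r hr hφr ψ, fun hψ => ?_⟩⟩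
  by_contra hne
  exact hφ N hN r hr hφr (.neg ψ) hne hψ

theorem exists_isPresentation {X : ℕ → Context} (s : ∀ i, CoVal (X i) (X (i + 1)))
    (hX : ∀ i, Nonempty (X i)) {p : ∀ i, CoVal (X i) M.carrier} (hp : ∀ i, p i ∈ M.V (X i))
    (hs : ∀ i, consolidate (s i) (p (i + 1)) = p i)
    (hgen : ∀ {Y : Context} (q : CoVal Y M.carrier), q ∈ M.V Y → ∃ i, q.Consolidates (p i)) :
    ∃ P : M.Presentation (.ofSucc X s hX), P.p = p := by
  refine ⟨⟨p, hp, fun {i j} hij => ?_, hgen⟩, rfl⟩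
  induction j, hij using Nat.le_induction with
  | base => rw [Tower.g_self, id_consolidate]
  | succ j hij ih =>
    have := Tower.ofSucc_g_step X s hX hij
    rw [show (Tower.ofSucc X s hX).g (hij.trans (Nat.le_succ j)) = _ from this,
      consolidate_assoc, hs, ih]

/-- Back and forth: if every type is isolated, then any two compact `ω`-models that satisfy the
same sentences are isomorphic. -/
theorem isomorphic_of_everyTypeIsolated [L.IsRelational]
    (hT : Theory.EveryTypeIsolated.{u, v, w} T) (hM : M.IsCompactOmegaModel T)
    (hN : N.IsCompactOmegaModel T)
    (hMN : ∀ φ : Formula L star, M.Sat φ M.total ↔ N.Sat φ N.total) : M.Isomorphic N := by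
  obtain ⟨hM, hMc, A, a, ha, -, hgenA⟩ := hM
  obtain ⟨hN, hNc, B, b, hb, -, hgenB⟩ := hN
  let St := {t : Σ X : Context, CoVal X M.carrier × CoVal X N.carrier //
    t.2.1 ∈ M.V t.1 ∧ t.2.2 ∈ N.V t.1 ∧ ∀ φ, M.Sat φ t.2.1 ↔ N.Sat φ t.2.2}
  -- One forth and one back move: fragment on the side of `M` below `a n` and transfer to `N`, then
  -- fragment there below `b n` and transfer back. This makes both chains cofinal.
  have step : ∀ (n : ℕ) (t : St), ∃ t' : St, ∃ g : CoVal t.1.1 t'.1.1,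
      consolidate g t'.1.2.1 = t.1.2.1 ∧ consolidate g t'.1.2.2 = t.1.2.2 ∧
        (a n).Consolidates t'.1.2.1 ∧ (b n).Consolidates t'.1.2.2 := by
    rintro n ⟨⟨X, p, q⟩, hp, hq, hpq⟩
    obtain ⟨Y, p', hp', ⟨g, rfl⟩, ⟨c, hc⟩⟩ := hM.1.directed _ _ p hp _ (ha n)
    obtain ⟨q', hq', hqq, hpq'⟩ := exists_fragmentation hT hM hN hp' hpq
    obtain ⟨Z, q'', hq'', ⟨g', hg'⟩, hd⟩ := hN.1.directed _ _ q' hq' _ (hb n)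
    subst hg'
    obtain ⟨p'', hp'', hpp, hpq''⟩ :=
      exists_fragmentation hT hN hM hq'' fun φ => (hpq' φ).symm
    refine ⟨⟨⟨Z, p'', q''⟩, hp'', hq'', fun φ => (hpq'' φ).symm⟩, consolidate g g',
      ?_, (consolidate_assoc _ _ _).trans hqq.symm, ⟨consolidate c g', ?_⟩, hd⟩
    · rw [consolidate_assoc, ← hpp]
    · rw [hc, consolidate_assoc, ← hpp]
  choose C G h1 h2 h3 h4 using step
  let seq : ℕ → St := fun n =>
    Nat.rec ⟨⟨star, M.total, N.total⟩, hM.1.total_mem, hN.1.total_mem, hMN⟩ (fun n t => C n t) n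
  have htrans : ∀ {K : ProtoStructure.{u, v, w} L} {X Y Z : Context} {p : CoVal X K.carrier}
      {q : CoVal Y K.carrier} {r : CoVal Z K.carrier}, p.Consolidates q → q.Consolidates r →
        p.Consolidates r := by
    rintro K X Y Z _ _ r ⟨g, rfl⟩ ⟨g', rfl⟩
    exact ⟨consolidate g g', (consolidate_assoc _ _ _).symm⟩
  have hne : ∀ i, Nonempty (seq i).1.1 := fun i => (seq i).1.2.1.rel_nonempty
  obtain ⟨P, hP⟩ := exists_isPresentation (M := M) (X := fun i => (seq i).1.1)
    (fun i => G i (seq i)) hne (p := fun i => (seq i).1.2.1) (fun i => (seq i).2.1)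
    (fun i => h1 i (seq i)) (fun {Y} q hq => by
      obtain ⟨i, hi⟩ := hgenA Y q hq
      exact ⟨i + 1, htrans hi (h3 i (seq i))⟩)
  obtain ⟨Q, hQ⟩ := exists_isPresentation (M := N) (X := fun i => (seq i).1.1)
    (fun i => G i (seq i)) hne (p := fun i => (seq i).1.2.2) (fun i => (seq i).2.2.1)
    (fun i => h2 i (seq i)) (fun {Y} q hq => by
      obtain ⟨i, hi⟩ := hgenB Y q hq
      exact ⟨i + 1, htrans hi (h4 i (seq i))⟩)
  refine P.isomorphic hMc hNc Q fun i φ => ?_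
  rw [hP, hQ]
  exact (seq i).2.2.2 φ

end ProtoStructure

end CovLogic

/-! ### Realizing and omitting types, compactness, and the equivalences. -/

namespace CovLogic

open CoVal

variable {L : FirstOrder.Language.{u, v}}

namespace Family

variable {B : Context} {T : Theory L}

/-- Substitution along the constant pattern turns a sentence of `T` into a formula in context `B`
that holds at every `v s`, hence at the generic co-valuation. -/
theorem exists_compactOmegaModel [L.IsRelational] [Countable (Σ n, L.Relations n)]
    (F : Family.{u, v, w, t} L B) (hT : ∀ s, (F.N s).IsModel T) {E : Set (Requirement L)}
    (hE : E.Countable) (hD : ∀ ρ ∈ E, F.Dense ρ) : ∃ M : ProtoStructure.{u, v, w} L,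
      M.IsCompactOmegaModel T ∧
        (∃ q ∈ M.V B, ∀ φ, (∀ᶠ s in F.l, (F.N s).Sat φ (F.v s)) → M.Sat φ q) ∧
          ∀ ρ ∈ E, ∀ q ∈ M.V ρ.Y, ρ.Holds M q := by
  obtain ⟨M, hM, hMc, hMω, ⟨q, hq, hqφ⟩, hME⟩ := F.exists_compact_omega hE hD
  refine ⟨M, ⟨⟨hM, fun φ hφ => ?_⟩, hMc, hMω⟩, ⟨q, hq, hqφ⟩, hME⟩
  have := q.rel_nonempty
  obtain ⟨φ', hφ'⟩ := Formula.exists_subst.{u, v, w} φ (CoVal.const star B)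
  rw [Subsingleton.elim M.total (consolidate (CoVal.const star B) q), ← hφ' M hM q hq]
  refine hqφ φ' (.of_forall fun s => ?_)
  rw [hφ' _ (F.isStructure s) _ (F.mem s), Subsingleton.elim (consolidate _ _) (F.N s).total]
  exact (hT s).2 φ hφ

end Family

namespace Theory

variable {T : Theory L}

/-- Every type is realized in a compact `ω`-model. -/
theorem IsTypeOf.exists_compactOmegaModel [L.IsRelational] [Countable (Σ n, L.Relations n)]
    {X : Context} {p : Set (Formula L X)} (hp : IsTypeOf.{u, v, w} T p) :
    ∃ M : ProtoStructure.{u, v, w} L, M.IsCompactOmegaModel T ∧ M.Realizes p := by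
  obtain ⟨N, hN, q, hq, hqp⟩ := hp
  let F : Family.{u, v, w, 0} L X := ⟨Unit, fun _ => N, fun _ => hN.1, fun _ => q, fun _ => hq, ⊤,
    inferInstance⟩
  obtain ⟨M, hM, ⟨r, hr, hrp⟩, -⟩ := F.exists_compactOmegaModel (T := T) (fun _ => hN)
    Set.countable_empty fun _ h => h.elim
  exact ⟨M, hM, r, hr, fun φ hφ => hrp φ (.of_forall fun _ => hqp φ hφ)⟩

/-- Compactness. -/
theorem exists_compactOmegaModel_of_finite [L.IsRelational] [Countable (Σ n, L.Relations n)]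
    {X : Context} (φ : ℕ → Formula L X) (h : ∀ n, ∃ N : ProtoStructure.{u, v, w} L, N.IsModel T ∧
      ∃ q ∈ N.V X, ∀ i ≤ n, N.Sat (φ i) q) :
    ∃ M : ProtoStructure.{u, v, w} L, M.IsCompactOmegaModel T ∧ ∃ q ∈ M.V X, ∀ i,
      M.Sat (φ i) q := by
  choose N hN q hq hφ using h
  let F : Family.{u, v, w, 0} L X := ⟨ℕ, N, fun n => (hN n).1, q, hq, Filter.atTop, inferInstance⟩
  obtain ⟨M, hM, ⟨r, hr, hrp⟩, -⟩ := F.exists_compactOmegaModel (T := T) hN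
    Set.countable_empty fun _ h => h.elim
  exact ⟨M, hM, r, hr, fun i => hrp _ ((Filter.eventually_ge_atTop i).mono fun n hn => hφ n i hn)⟩

/-- Omitting types. -/
theorem exists_compactOmegaModel_not_realizes [L.IsRelational] [Countable (Σ n, L.Relations n)]
    (hT : Consistent.{u, v, w} T) {X : Context} {p : Set (Formula L X)}
    (hp : ¬ IsIsolated.{u, v, w} T p) :
    ∃ M : ProtoStructure.{u, v, w} L, M.IsCompactOmegaModel T ∧ ¬ M.Realizes p := by
  obtain ⟨N, hN⟩ := hT
  have : Nonempty {N : ProtoStructure.{u, v, w} L // N.IsModel T} := ⟨⟨N, hN⟩⟩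
  -- For the filter `⊤`, frequently means in some model, so a condition is good exactly when some
  -- model of `T` realizes it.
  let F : Family.{u, v, w, max u v (w + 1)} L star :=
    ⟨{N : ProtoStructure.{u, v, w} L // N.IsModel T}, fun N => N.1, fun N => N.2.1,
      fun N => N.1.total, fun N => N.2.1.total_mem, ⊤,
      inferInstance⟩
  let ρ : Requirement L := ⟨X, (fun ψ => ⟨X, CoVal.id X, .neg ψ⟩) '' p⟩
  have hρ : F.Dense ρ := by
    intro c hc h
    obtain ⟨K, k, hk, -, hck⟩ := Filter.Frequently.exists hc
    by_contra hne
    -- If a good condition were compatible with no `¬ψ`, `ψ ∈ p`, then the formula saying that it is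
    -- realized by a fragmentation of pattern `h` would isolate `p`.
    refine hp ⟨.ex h c.φ, ⟨K.1, K.2, _, K.1.closed h k hk, ?_⟩, ?_⟩
    · rintro _ rfl
      exact ⟨k, hk, rfl, hck⟩
    · rintro N hN _ hq ⟨r, hr, rfl, hs⟩ ψ hψ
      by_contra hψs
      refine hne ⟨⟨X, CoVal.id X, .neg ψ⟩, ⟨ψ, hψ, rfl⟩,
        Filter.frequently_top.2 ⟨⟨N, hN⟩, r, ?_, ?_⟩⟩
      · exact ⟨hr, Subsingleton.elim _ _, hs⟩
      · exact ⟨consolidate h r, hq, id_consolidate _, hψs⟩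
  obtain ⟨M, hM, -, hME⟩ := F.exists_compactOmegaModel (T := T) (fun N => N.2)
    (Set.countable_singleton ρ) (by rintro _ rfl; exact hρ)
  refine ⟨M, hM, ?_⟩
  rintro ⟨q, hq, hqp⟩
  obtain ⟨_, ⟨ψ, hψ, rfl⟩, r, hr, hrq, hrψ⟩ := hME ρ rfl q hq
  refine hrψ ?_
  rw [id_consolidate] at hrq
  rw [hrq]
  exact hqp ψ hψ

theorem OmegaCategorical.everyTypeIsolated [L.IsRelational] [Countable (Σ n, L.Relations n)]
    (hT : OmegaCategorical.{u, v, w} T) : EveryTypeIsolated.{u, v, w} T := by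
  intro X p hp
  by_contra hne
  obtain ⟨M, hM, huniq⟩ := hT
  obtain ⟨M₁, hM₁, hr₁⟩ := hp.exists_compactOmegaModel
  obtain ⟨M₂, hM₂, hr₂⟩ := exists_compactOmegaModel_not_realizes ⟨M, hM.1⟩ hne
  exact hr₂ ((huniq M₂ hM₂).realizes_iff.1 ((huniq M₁ hM₁).realizes_iff.2 hr₁))

theorem EveryTypeIsolated.omegaCategorical [L.IsRelational] [Countable (Σ n, L.Relations n)]
    (hT : EveryTypeIsolated.{u, v, w} T) (hcons : Consistent.{u, v, w} T)
    (hcomp : Complete.{u, v, w} T) : OmegaCategorical.{u, v, w} T := by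
  obtain ⟨K, hK⟩ := hcons
  obtain ⟨M, hM, -⟩ := IsTypeOf.exists_compactOmegaModel (T := T) (p := (∅ : Set (Formula L star)))
    ⟨K, hK, _, hK.1.total_mem, fun _ h => h.elim⟩
  refine ⟨M, hM, fun N hN => ProtoStructure.isomorphic_of_everyTypeIsolated hT hM hN fun φ => ?_⟩
  rcases hcomp φ with h | h
  · exact iff_of_true (h M hM.1) (h N hN.1)
  · exact iff_of_false (h M hM.1) (h N hN.1)

theorem exists_eq_of_mem_typeSpace {n : ℕ} {p : Set (Formula L (Finset.range n))}
    (hp : p ∈ typeSpace.{u, v, w} T n) : ∃ M : ProtoStructure.{u, v, w} L, M.IsModel T ∧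
      ∃ q ∈ M.V (Finset.range n), p = {φ | M.Sat φ q} := by
  obtain ⟨hc, M, hM, q, hq, hqp⟩ := hp
  refine ⟨M, hM, q, hq, Set.Subset.antisymm hqp fun φ hφ => ?_⟩
  exact (hc φ).resolve_right fun h => hqp _ h hφ

theorem mem_typeSpace {n : ℕ} {M : ProtoStructure.{u, v, w} L} (hM : M.IsModel T)
    {q : CoVal (Finset.range n) M.carrier} (hq : q ∈ M.V (Finset.range n)) :
    {φ | M.Sat φ q} ∈ typeSpace.{u, v, w} T n :=
  ⟨fun φ => em (M.Sat φ q), M, hM, q, hq, fun _ h => h⟩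

theorem EveryTypeIsolated.finite_typeSpace [L.IsRelational] [Countable (Σ n, L.Relations n)]
    (hT : EveryTypeIsolated.{u, v, w} T) (n : ℕ) : (typeSpace.{u, v, w} T n).Finite := by
  by_contra hinf
  have hS : ∀ p : typeSpace.{u, v, w} T n, ∃ φ : Formula L (Finset.range n),
      ∀ q ∈ typeSpace.{u, v, w} T n, φ ∈ q ↔ q = p := by
    rintro ⟨p, hp⟩
    obtain ⟨φ, ⟨K, hK, k, hk, hφk⟩, hφ⟩ := hT _ p hp.2
    have key : ∀ q ∈ typeSpace.{u, v, w} T n, φ ∈ q → q = p := by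
      intro q hq hφq
      obtain ⟨M, hM, r, hr, rfl⟩ := exists_eq_of_mem_typeSpace hq
      refine Set.Subset.antisymm (fun ψ hψ => ?_) (hφ M hM r hr hφq)
      exact (hp.1 ψ).resolve_right fun h => hφ M hM r hr hφq _ h hψ
    refine ⟨φ, fun q hq => ⟨key q hq, ?_⟩⟩
    rintro rfl
    exact key _ (mem_typeSpace hK hk) (hφk φ rfl) ▸ hφk φ rfl
  choose φ hφ using hS
  have hne : Nonempty (typeSpace.{u, v, w} T n) :=
    (Set.Infinite.nonempty hinf).to_subtype
  have hcount : Countable (typeSpace.{u, v, w} T n) := by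
    refine Function.Injective.countable (f := φ) fun p q hpq => Subtype.ext ?_
    rw [← hφ q p p.2, ← hpq, hφ p p p.2]
  obtain ⟨e, he⟩ := exists_surjective_nat (typeSpace.{u, v, w} T n)
  -- Finitely many isolating formulas exclude only finitely many of the infinitely many types, so
  -- all of them can be negated at once; the resulting type escapes the enumeration.
  obtain ⟨M, hM, q, hq, hqs⟩ := exists_compactOmegaModel_of_finite (T := T)
    (fun i => .neg (φ (e i))) fun m => by
      obtain ⟨p, hp, hpm⟩ := Set.Infinite.exists_notMem_finite hinf
        ((Set.finite_Iic m).image fun i => (e i).1)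
      obtain ⟨M, hM, q, hq, rfl⟩ := exists_eq_of_mem_typeSpace hp
      exact ⟨M, hM, q, hq, fun i hi hs => hpm ⟨i, hi, ((hφ _ _ hp).1 hs).symm⟩⟩
  obtain ⟨i, hi⟩ := he ⟨_, mem_typeSpace hM.1 hq⟩
  refine hqs i ?_
  rw [hi]
  exact (hφ _ _ (mem_typeSpace hM.1 hq)).2 rfl

theorem everyTypeIsolated_of_finite (hT : ∀ n, (typeSpace.{u, v, w} T n).Finite) :
    EveryTypeIsolated.{u, v, w} T := by
  rintro X p ⟨M, hM, q, hq, hqp⟩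
  let e : X ≃ Finset.range X.card := X.equivOfCardEq (Finset.card_range _).symm
  let g := graph e e.surjective
  let g' := graph e.symm e.symm.surjective
  have hgg : consolidate g' g = CoVal.id X := by
    ext x y
    constructor
    · rintro ⟨z, hz, rfl⟩
      exact hz.symm.trans (e.symm_apply_apply y) |>.symm ▸ rfl
    · rintro rfl
      exact ⟨e x, e.symm_apply_apply x, rfl⟩
  have := (hT X.card).to_subtype
  -- Each complete type other than that of `consolidate g q` omits some formula true there. The
  -- conjunction of these over the finite type space isolates the whole type of `q`, hence `p`.
  have hsep : ∀ t : typeSpace.{u, v, w} T X.card, ∃ ψ : Formula L (Finset.range X.card),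
      M.Sat ψ (consolidate g q) ∧ (t.1 ≠ {φ | M.Sat φ (consolidate g q)} → ψ ∉ t.1) := by
    rintro ⟨t, ht⟩
    by_contra! hne
    obtain ⟨h1, h2⟩ := hne (.neg .bot) fun h => h
    refine h1 (Set.Subset.antisymm (fun ψ hψ => ?_) fun ψ hψ => (hne ψ hψ).2)
    by_contra hψ'
    obtain ⟨N, hN, r, hr, rfl⟩ := exists_eq_of_mem_typeSpace ht
    exact (hne (.neg ψ) hψ').2 hψ
  choose ψ hψ hψ' using hsep
  obtain ⟨θ, hθ⟩ := Formula.exists_iInf.{u, v, w} ψ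
  obtain ⟨θ', hθ'⟩ := Formula.exists_subst.{u, v, w} θ g
  refine ⟨θ', ⟨M, hM, q, hq, ?_⟩, fun N hN r hr hs φ hφ => ?_⟩
  · rintro _ rfl
    exact (hθ' M hM.1 q hq).2 ((hθ _ _).2 hψ)
  · rw [hθ' N hN.1 r hr, hθ] at hs
    have ht := mem_typeSpace hN (N.closed g r hr)
    have heq : {φ | N.Sat φ (consolidate g r)} = {φ | M.Sat φ (consolidate g q)} := by
      by_contra hne
      exact hψ' ⟨_, ht⟩ hne (hs ⟨_, ht⟩)
    obtain ⟨φ', hφ'⟩ := Formula.exists_subst.{u, v, w} φ g'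
    have h1 : ∀ K : ProtoStructure.{u, v, w} L, K.IsModel T → ∀ s ∈ K.V X,
        (K.Sat φ' (consolidate g s) ↔ K.Sat φ s) := fun K hK s hs => by
      rw [hφ' K hK.1 _ (K.closed g s hs), ← consolidate_assoc, hgg, id_consolidate]
    rw [← h1 N hN r hr]
    have h2 : φ' ∈ {φ | M.Sat φ (consolidate g q)} := (h1 M hM q hq).2 (hqp φ hφ)
    rw [← heq] at h2
    exact h2

end Theory

end CovLogic

theorem mainTheorem9 (L : FirstOrder.Language.{u, v}) [L.IsRelational]
    [Countable (Σ n, L.Relations n)] (T : CovLogic.Theory L) :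
    (CovLogic.Theory.OmegaCategorical.{u, v, w} T →
      CovLogic.Theory.EveryTypeIsolated.{u, v, w} T) ∧
    (CovLogic.Theory.EveryTypeIsolated.{u, v, w} T ↔
      ∀ n : ℕ, (CovLogic.Theory.typeSpace.{u, v, w} T n).Finite) ∧
    (CovLogic.Theory.Consistent.{u, v, w} T → CovLogic.Theory.Complete.{u, v, w} T →
      [CovLogic.Theory.OmegaCategorical.{u, v, w} T,
        CovLogic.Theory.EveryTypeIsolated.{u, v, w} T,
        ∀ n : ℕ, (CovLogic.Theory.typeSpace.{u, v, w} T n).Finite].TFAE) := by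
  have h12 := fun hT : CovLogic.Theory.OmegaCategorical.{u, v, w} T => hT.everyTypeIsolated
  have h23 : CovLogic.Theory.EveryTypeIsolated.{u, v, w} T ↔
      ∀ n : ℕ, (CovLogic.Theory.typeSpace.{u, v, w} T n).Finite :=
    ⟨fun hT => hT.finite_typeSpace, CovLogic.Theory.everyTypeIsolated_of_finite⟩
  refine ⟨h12, h23, fun hcons hcomp => ?_⟩
  tfae_have 1 → 2 := h12
  tfae_have 2 ↔ 3 := h23
  tfae_have 2 → 1 := fun hT => hT.omegaCategorical hcons hcomp
  tfae_finish
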